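/- Let $f(t)=1/(1+e^{-t})$ be the standard sigmoid, let $\mathcal N$ be the standard Gaussian distribution on $\mathbb R$, and write $\|g\|_2=\mathbb E_{t\sim\mathcal N}[g(t)^2]^{1/2}$. **(1) Degree.** For every $\varepsilon>0$ there is a smallest integer $d=d(\varepsilon)\ge 0$ for which there exists a real polynomial $p$ of degree at most $d$ with $\|f-p\|_2<\varepsilon$, and $$d(\varepsilon)=\Theta\big(\log^2(1/\varepsilon)\big)\qquad\text{as }\varepsilon\to 0^+ .$$ **(2) Hermite coefficients.** Let $\hat f(i)=\mathbb E_{t\sim\mathcal N}[f(t)\,He_i(t)/\sqrt{i!}]$, where $He_i$ is the probabilists' Hermite polynomial of degree $i$. Then $|\hat f(2i-1)|=e^{-\Theta(\sqrt i)}$: there are constants $a,b>0$ such that $e^{-b\sqrt i}\le|\hat f(2i-1)|\le e^{-a\sqrt i}$ for all integers $i\ge1$. **(3) CSQ lower bound.** Let $\mathcal N_n$ be the standard Gaussian distribution on $\mathbb R^n$. A correlational statistical query (CSQ) algorithm for a distribution $D$ on $\mathbb R^n\times\mathbb R$ does not see samples, but adaptively asks queries $(h,\tau)$, where $h:\mathbb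 R^n\to\mathbb R$ is measurable with $\mathbb E_{x\sim\mathcal N_n}[h(x)^2]\le1$ and $\tau>0$ is the tolerance; an oracle answers with some number within $\tau$ of $\mathbb E_{(x,y)\sim D}[h(x)y]$. After finitely many queries the algorithm outputs a measurable hypothesis $\mathbb R^n\to\mathbb R$; it may be randomized. It *agnostically learns* a class $\mathcal C$ of functions $\mathbb R^n\to\mathbb R$ to $L^2$-error $\mathrm{OPT}+\varepsilon$ if for every $D$ with $x$-marginal $\mathcal N_n$ and $\mathbb E_D[y^2]<\infty$, and for every valid oracle for $D$, with probability at least $2/3$ its output $h$ satisfies $$\mathbb E_{(x,y)\sim D}[(h(x)-y)^2]^{1/2}\le\inf_{g\in\mathcal C}\mathbb E_{(x,y)\sim D}[(g(x)-y)^2]^{1/2}+\varepsilon .$$ There are constants $c>0$ and $\varepsilon_0\in(0,1)$ such that the following holds for all integers $n\ge1$ and all $\varepsilon$ with $n^{-c}\le\varepsilon<\varepsilon_0$. Let $\mathcal C$ be any class of measurable functions on $\mathbb R^n$ that contains $x\mapsto f(\langle w,x\rangle)$ for all unit vectors $w\in\mathbb R^n$. Then any CSQ algorithm that agnostically learns $\mathcal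 C$ to $L^2$-error $\mathrm{OPT}+\varepsilon$ must, for some such distribution, some valid oracle and some value of its random seed, either ask a query of tolerance at most $n^{-c\log^2(1/\varepsilon)}$ or ask at least $2^{n^{c}}$ queries. -/

import Mathlib

open MeasureTheory ProbabilityTheory Filter Topology Asymptotics Polynomial

noncomputable section

/-- `p` is within `L²(𝒩(0,1))`-distance strictly less than `ε` of the standard sigmoid
`t ↦ 1 / (1 + e⁻ᵗ)`. -/
def ApproximatesSigmoid (p : ℝ[X]) (ε : ℝ) : Prop :=
  eLpNorm (fun t : ℝ => Real.sigmoid t - p.eval t) 2 (gaussianReal 0 1) < ENNReal.ofReal ε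

/-- The degrees `d` such that some real polynomial of degree at most `d` approximates the sigmoid
to `L²(𝒩(0,1))`-error less than `ε`. -/
def sigmoidDegrees (ε : ℝ) : Set ℕ :=
  {d | ∃ p : ℝ[X], p.natDegree ≤ d ∧ ApproximatesSigmoid p ε}

/-- The least element of `sigmoidDegrees ε`. -/
def sigmoidDegree (ε : ℝ) : ℕ := sInf (sigmoidDegrees ε)

/-- The `i`-th Hermite coefficient `𝔼_{t ∼ 𝒩(0,1)} [f t * Heᵢ t / √(i!)]` of `f`, where `Heᵢ` is
the probabilists' Hermite polynomial. -/
def hermiteCoeff (f : ℝ → ℝ) (i : ℕ) : ℝ :=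
  ∫ t, f t * (aeval t (hermite i) / Real.sqrt (Nat.factorial i)) ∂(gaussianReal 0 1)

/-- The standard Gaussian distribution on `ℝⁿ`. -/
def stdGaussianPi (n : ℕ) : Measure (Fin n → ℝ) := Measure.pi fun _ => gaussianReal 0 1

/-- A correlational statistical query on `ℝⁿ`: a query function of Gaussian `L²`-norm at most `1`
(in particular any measurable function with values in `[-1, 1]`) and a positive tolerance. -/
structure CSQQuery (n : ℕ) where
  toFun : (Fin n → ℝ) → ℝ
  measurable_toFun : Measurable toFun
  norm_le_one : eLpNorm toFun 2 (stdGaussianPi n) ≤ 1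
  tolerance : ℝ
  tolerance_pos : 0 < tolerance

/-- A deterministic adaptive CSQ algorithm on `ℝⁿ` as a decision tree: it either stops and outputs
a measurable hypothesis, or asks a query and continues depending on the real number returned.
There is no bound on the computation done between the queries. -/
inductive CSQAlgorithm (n : ℕ) : Type where
  | output (h : (Fin n → ℝ) → ℝ) (hh : Measurable h) : CSQAlgorithm n
  | query (q : CSQQuery n) (next : ℝ → CSQAlgorithm n) : CSQAlgorithm n

/-- The hypothesis output by the algorithm when the queries are answered by `O`. -/
def CSQAlgorithm.hypothesis {n : ℕ} (O : CSQQuery n → ℝ) :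
    CSQAlgorithm n → ((Fin n → ℝ) → ℝ)
  | .output h _ => h
  | .query q next => (next (O q)).hypothesis O

/-- The list of queries asked by the algorithm when the queries are answered by `O`. -/
def CSQAlgorithm.queries {n : ℕ} (O : CSQQuery n → ℝ) : CSQAlgorithm n → List (CSQQuery n)
  | .output _ _ => []
  | .query q next => q :: (next (O q)).queries O

/-- `D` is a distribution of labelled examples `(x, y)` on `ℝⁿ × ℝ` whose `x`-marginal is the
standard Gaussian, and whose labels are square-integrable (so that the square loss is finite). -/
def IsGaussianLabelled {n : ℕ} (D : Measure ((Fin n → ℝ) × ℝ)) : Prop :=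
  D.map Prod.fst = stdGaussianPi n ∧ MemLp Prod.snd 2 D

/-- `O` is a valid CSQ oracle for `D`: it answers every query `(h, τ)` by a number
at distance at most `τ` from `𝔼_{(x, y) ∼ D} [h x * y]`. -/
def IsCSQOracle {n : ℕ} (D : Measure ((Fin n → ℝ) × ℝ)) (O : CSQQuery n → ℝ) : Prop :=
  ∀ q : CSQQuery n, |O q - ∫ z, q.toFun z.1 * z.2 ∂D| ≤ q.tolerance

/-- The `L²`-error `𝔼_{(x, y) ∼ D} [(h x - y)²]^{1/2}`. -/
def l2Error {n : ℕ} (D : Measure ((Fin n → ℝ) × ℝ)) (h : (Fin n → ℝ) → ℝ) : ENNReal :=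
  eLpNorm (fun z => h z.1 - z.2) 2 D

/-- The optimal `L²`-error of a concept in the class `C`. -/
def optError {n : ℕ} (D : Measure ((Fin n → ℝ) × ℝ)) (C : Set ((Fin n → ℝ) → ℝ)) : ENNReal :=
  ⨅ f ∈ C, l2Error D f

/-- The randomized CSQ algorithm `A` (a random deterministic algorithm, with random seed
`ω ∼ P`) agnostically learns the class `C` under Gaussian marginals to `L²`-error `OPT + ε`: for
each distribution `D` with Gaussian `x`-marginal and each valid oracle for `D`,
with probability at least `2/3` its hypothesis has error at most `OPT + ε`. -/
def AgnosticallyLearns {n : ℕ} {Ω : Type*} [MeasurableSpace Ω] (P : Measure Ω)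
    (A : Ω → CSQAlgorithm n) (C : Set ((Fin n → ℝ) → ℝ)) (ε : ℝ) : Prop :=
  ∀ D : Measure ((Fin n → ℝ) × ℝ), IsGaussianLabelled D →
    ∀ O : CSQQuery n → ℝ, IsCSQOracle D O →
      ∃ S : Set Ω, MeasurableSet S ∧ 2 / 3 ≤ P S ∧
        ∀ ω ∈ S, l2Error D ((A ω).hypothesis O) ≤ optError D C + ENNReal.ofReal ε

/-- `C` is a class of (measurable) concepts on `ℝⁿ` that includes all the sigmoids
`x ↦ 1 / (1 + e^{-⟨w, x⟩})` with `w` a unit vector. -/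
def IncludesSigmoids {n : ℕ} (C : Set ((Fin n → ℝ) → ℝ)) : Prop :=
  (∀ f ∈ C, Measurable f) ∧
    ∀ w : Fin n → ℝ, w ⬝ᵥ w = 1 → (fun x : Fin n → ℝ => Real.sigmoid (w ⬝ᵥ x)) ∈ C

end

/-! ### Hermite polynomials under the standard Gaussian -/

/-! Parts (1) and (2) rest on the sine transform f(t) - 1/2 = ∫₀^∞ sin(tu)/sinh(πu) du
(`integral_sin_div_sinh`), a form of the partial fractions of coth. Gaussian integration by parts
gives E[sin(ut) Heₙ(t)] = ±uⁿ e^{-u²/2} for odd n and 0 for even n. For odd n the coefficient is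
therefore, up to sign, (n!)^{-1/2} ∫₀^∞ uⁿ e^{-u²/2}/sinh(πu) du. The factor uⁿ e^{-u²/2} is a bump
of bounded width at u = √n whose height is √n! up to e^{O(√n)}, and 1/sinh(πu) is e^{-Θ(√n)} there;
see `exists_abs_hermiteCoeff_sigmoid_le` and `exp_le_abs_hermiteCoeff_sigmoid`.

The normalized Hermite polynomials form a Hilbert basis, so truncating the expansion at degree d
leaves error e^{-Ω(√d)}. Conversely, a polynomial of degree below n does not affect the n-th
coefficient, so its error is at least that coefficient. Together these give degree Θ(log²(1/ε)).

For (3), take an odd m of order log²(1/ε) whose coefficient is at least 4ε, and labels y_w = λ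
hₘ(⟨w,x⟩), with hₘ the normalized Hermite polynomial and λ the inverse of the coefficient. The
sigmoid in direction w has correlation 1 with y_w, which improves the squared error enough that a
learner must output something correlated with y_w. Distinct labels have correlation λ²⟨w,v⟩ᵐ
(`integral_normHermite_dotProduct_mul`), which is tiny on a huge family of nearly orthogonal w
(`exists_nearly_orthogonal`). By an approximate Bessel inequality (`card_mul_le_one_of_correlated`),
each query or hypothesis correlates with few members, so zero is a legal answer for most of them and
the run reveals too little (`csq_lower_bound_of_nearly_orthogonal`). -/

lemma integrable_pow_gaussianReal (k : ℕ) : Integrable (fun t : ℝ => t ^ k) (gaussianReal 0 1) :=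
  integrable_pow_of_mem_interior_integrableExpSet (X := id)
    (by simp [integrableExpSet_id_gaussianReal]) k

lemma integrable_eval_gaussianReal (p : ℝ[X]) :
    Integrable (fun t : ℝ => p.eval t) (gaussianReal 0 1) := by
  simp_rw [Polynomial.eval_eq_sum_range]
  exact integrable_finsetSum _ fun k _ => (integrable_pow_gaussianReal k).const_mul _

/-- The probabilists' Hermite polynomial with real coefficients. -/
noncomputable def hermiteReal (n : ℕ) : ℝ[X] := (hermite n).map (Int.castRingHom ℝ)

lemma aeval_hermite_eq_eval (n : ℕ) (t : ℝ) : aeval t (hermite n) = (hermiteReal n).eval t := by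
  rw [hermiteReal, eval_map, aeval_def]; rfl

lemma hermiteReal_zero : hermiteReal 0 = 1 := by simp [hermiteReal]

lemma hermiteReal_succ (n : ℕ) :
    hermiteReal (n + 1) = X * hermiteReal n - derivative (hermiteReal n) := by
  simp [hermiteReal, hermite_succ, derivative_map]

lemma natDegree_hermiteReal (n : ℕ) : (hermiteReal n).natDegree = n := by
  rw [hermiteReal, (hermite_monic n).natDegree_map, natDegree_hermite]

lemma monic_hermiteReal (n : ℕ) : (hermiteReal n).Monic := (hermite_monic n).map _

lemma derivative_hermiteReal_succ (n : ℕ) :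
    derivative (hermiteReal (n + 1)) = ((n + 1 : ℕ) : ℝ[X]) * hermiteReal n := by
  induction n with
  | zero => simp [hermiteReal_succ, hermiteReal_zero]
  | succ n ih =>
    rw [hermiteReal_succ (n + 1), derivative_sub, derivative_mul, derivative_X, ih,
      derivative_mul, derivative_natCast]
    have h := hermiteReal_succ n
    push_cast
    linear_combination (n + 1 : ℝ[X]) * (-h)

lemma iterate_derivative_hermiteReal_self (n : ℕ) :
    derivative^[n] (hermiteReal n) = ((n.factorial : ℕ) : ℝ[X]) := by
  induction n with
  | zero => simp [hermiteReal_zero]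
  | succ n ih =>
    rw [Function.iterate_succ_apply, derivative_hermiteReal_succ,
      iterate_derivative_natCast_mul, ih, Nat.factorial_succ, Nat.cast_mul]

lemma integrable_gaussianReal_iff {g : ℝ → ℝ} :
    Integrable g (gaussianReal 0 1) ↔
      Integrable (fun t => gaussianPDFReal 0 1 t * g t) := by
  rw [gaussianReal_of_var_ne_zero _ one_ne_zero, integrable_withDensity_iff_integrable_smul'
    (measurable_gaussianPDF 0 1) (Eventually.of_forall fun _ => gaussianPDF_lt_top)]
  simp [toReal_gaussianPDF]

lemma hasDerivAt_gaussianPDFReal (t : ℝ) :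
    HasDerivAt (gaussianPDFReal 0 1) (-(t * gaussianPDFReal 0 1 t)) t := by
  have h : HasDerivAt (fun x : ℝ => (√(2 * Real.pi * (1 : NNReal)))⁻¹ *
      Real.exp (-(x - 0) ^ 2 / (2 * (1 : NNReal))))
      ((√(2 * Real.pi * (1 : NNReal)))⁻¹ * (Real.exp (-(t - 0) ^ 2 / (2 * (1 : NNReal))) *
        (-t))) t := by
    refine (HasDerivAt.exp ?_).const_mul _
    have := ((((hasDerivAt_id t).sub_const 0).pow 2).neg).div_const (2 * ((1 : NNReal) : ℝ))
    refine this.congr_deriv ?_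
    simp
    ring
  refine h.congr_deriv ?_
  rw [gaussianPDFReal]
  ring

/-- Gaussian integration by parts against Hermite polynomials. -/
lemma integral_mul_hermiteReal_succ (n : ℕ) {F F' : ℝ → ℝ} (hF : ∀ t, HasDerivAt F (F' t) t)
    (h₁ : Integrable (fun t => F t * (hermiteReal (n + 1)).eval t) (gaussianReal 0 1))
    (h₂ : Integrable (fun t => F' t * (hermiteReal n).eval t) (gaussianReal 0 1))
    (h₃ : Integrable (fun t => F t * (hermiteReal n).eval t) (gaussianReal 0 1)) :
    ∫ t, F t * (hermiteReal (n + 1)).eval t ∂(gaussianReal 0 1) =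
      ∫ t, F' t * (hermiteReal n).eval t ∂(gaussianReal 0 1) := by
  -- With φ the Gaussian density, the Hermite recursion says exactly that (φ Heₙ)' = -φ Heₙ₊₁.
  have hv : ∀ t, HasDerivAt (fun t => gaussianPDFReal 0 1 t * (hermiteReal n).eval t)
      (-(gaussianPDFReal 0 1 t * (hermiteReal (n + 1)).eval t)) t := fun t => by
    refine ((hasDerivAt_gaussianPDFReal t).mul ((hermiteReal n).hasDerivAt t)).congr_deriv ?_
    rw [hermiteReal_succ]
    simp only [eval_sub, eval_mul, eval_X]
    ring
  rw [integrable_gaussianReal_iff] at h₁ h₂ h₃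
  have key := integral_mul_deriv_eq_deriv_mul_of_integrable (fun t _ => hF t) (fun t _ => hv t)
    (by convert h₁.neg using 1; ext t; simp only [Pi.mul_apply, Pi.neg_apply]; ring)
    (by convert h₂ using 1; ext t; simp only [Pi.mul_apply]; ring)
    (by convert h₃ using 1; ext t; simp only [Pi.mul_apply]; ring)
  simp_rw [integral_gaussianReal_eq_integral_smul one_ne_zero, smul_eq_mul]
  rw [← neg_inj, ← integral_neg]
  convert key using 1
  · congr 1; ext t; ring
  · congr 2; ext t; ring

/-- Integration by parts n times. Orthogonality and the norm n! are both special cases. -/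
lemma integral_eval_mul_hermiteReal (p : ℝ[X]) (n : ℕ) :
    ∫ t, p.eval t * (hermiteReal n).eval t ∂(gaussianReal 0 1) =
      ∫ t, (derivative^[n] p).eval t ∂(gaussianReal 0 1) := by
  induction n generalizing p with
  | zero => simp [hermiteReal_zero]
  | succ n ih =>
    rw [integral_mul_hermiteReal_succ n (fun t => p.hasDerivAt t), ih,
      Function.iterate_succ_apply]
    all_goals
      simp_rw [← eval_mul]
      exact integrable_eval_gaussianReal _

lemma integral_eval_mul_hermiteReal_eq_zero {p : ℝ[X]} {n : ℕ} (h : p.natDegree < n) :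
    ∫ t, p.eval t * (hermiteReal n).eval t ∂(gaussianReal 0 1) = 0 := by
  simp [integral_eval_mul_hermiteReal, iterate_derivative_eq_zero h]

lemma integral_hermiteReal_mul_self (n : ℕ) :
    ∫ t, (hermiteReal n).eval t * (hermiteReal n).eval t ∂(gaussianReal 0 1) = n.factorial := by
  simp [integral_eval_mul_hermiteReal, iterate_derivative_hermiteReal_self]

lemma integral_hermiteReal_mul_of_ne {m n : ℕ} (h : m ≠ n) :
    ∫ t, (hermiteReal m).eval t * (hermiteReal n).eval t ∂(gaussianReal 0 1) = 0 := by
  rcases h.lt_or_gt with h | h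
  · exact integral_eval_mul_hermiteReal_eq_zero (by rwa [natDegree_hermiteReal])
  · simp_rw [mul_comm ((hermiteReal m).eval _)]
    exact integral_eval_mul_hermiteReal_eq_zero (by rwa [natDegree_hermiteReal])

/-! ### Gaussian integrals of sine and cosine against Hermite polynomials -/

lemma integral_cos_gaussianReal (u : ℝ) :
    ∫ t, Real.cos (u * t) ∂(gaussianReal 0 1) = Real.exp (-u ^ 2 / 2) := by
  have h := charFun_gaussianReal (μ := 0) (v := 1) u
  rw [charFun_apply_real] at h
  have h' := congrArg Complex.re h
  rw [← RCLike.re_eq_complex_re, ← integral_re] at h'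
  · convert h' using 1
    · congr 1; ext t
      rw [RCLike.re_eq_complex_re, ← Complex.ofReal_mul, Complex.exp_ofReal_mul_I_re]
    · have : ((u : ℂ) * ((0 : ℝ) : ℂ) * Complex.I - ((1 : NNReal) : ℝ) * (u : ℂ) ^ 2 / 2) =
          ((-u ^ 2 / 2 : ℝ) : ℂ) := by
        push_cast; ring
      rw [this, RCLike.re_eq_complex_re, Complex.exp_ofReal_re]
  · refine (integrable_const (1 : ℝ)).mono' (by fun_prop) (Eventually.of_forall fun t => ?_)
    rw [← Complex.ofReal_mul, Complex.norm_exp_ofReal_mul_I]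

lemma integrable_bdd_mul_eval {F : ℝ → ℝ} (hF : Continuous F) {c : ℝ} (hc : ∀ t, |F t| ≤ c)
    (p : ℝ[X]) : Integrable (fun t => F t * p.eval t) (gaussianReal 0 1) :=
  (integrable_eval_gaussianReal p).bdd_mul (c := c) hF.aestronglyMeasurable
    (Eventually.of_forall hc)

lemma integral_sin_mul_hermiteReal_succ (u : ℝ) (n : ℕ) :
    ∫ t, Real.sin (u * t) * (hermiteReal (n + 1)).eval t ∂(gaussianReal 0 1) =
      u * ∫ t, Real.cos (u * t) * (hermiteReal n).eval t ∂(gaussianReal 0 1) := by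
  rw [integral_mul_hermiteReal_succ n (F' := fun t => u * Real.cos (u * t))]
  · simp_rw [mul_assoc]; rw [integral_const_mul]
  · intro t
    refine ((hasDerivAt_id t).const_mul u).sin.congr_deriv ?_
    simp [mul_comm]
  · exact integrable_bdd_mul_eval (by fun_prop) (fun t => Real.abs_sin_le_one _) _
  · simp_rw [mul_assoc]
    exact (integrable_bdd_mul_eval (by fun_prop) (fun t => Real.abs_cos_le_one _) _).const_mul u
  · exact integrable_bdd_mul_eval (by fun_prop) (fun t => Real.abs_sin_le_one _) _

lemma integral_cos_mul_hermiteReal_succ (u : ℝ) (n : ℕ) :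
    ∫ t, Real.cos (u * t) * (hermiteReal (n + 1)).eval t ∂(gaussianReal 0 1) =
      -(u * ∫ t, Real.sin (u * t) * (hermiteReal n).eval t ∂(gaussianReal 0 1)) := by
  rw [integral_mul_hermiteReal_succ n (F' := fun t => -u * Real.sin (u * t))]
  · simp_rw [mul_assoc]; rw [integral_const_mul, neg_mul]
  · intro t
    refine ((hasDerivAt_id t).const_mul u).cos.congr_deriv ?_
    simp [mul_comm]
  · exact integrable_bdd_mul_eval (by fun_prop) (fun t => Real.abs_cos_le_one _) _
  · simp_rw [mul_assoc]
    exact (integrable_bdd_mul_eval (by fun_prop) (fun t => Real.abs_sin_le_one _) _).const_mul _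
  · exact integrable_bdd_mul_eval (by fun_prop) (fun t => Real.abs_cos_le_one _) _

/-- Two integrations by parts multiply either integral by -u². The base case is oddness of sine and
the Gaussian characteristic function. -/
lemma integral_sin_cos_mul_hermiteReal_two_mul (u : ℝ) (k : ℕ) :
    ∫ t, Real.sin (u * t) * (hermiteReal (2 * k)).eval t ∂(gaussianReal 0 1) = 0 ∧
    ∫ t, Real.cos (u * t) * (hermiteReal (2 * k)).eval t ∂(gaussianReal 0 1) =
      (-1) ^ k * (u ^ (2 * k) * Real.exp (-u ^ 2 / 2)) := by
  induction k with
  | zero =>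
    refine ⟨?_, by simp [hermiteReal_zero, integral_cos_gaussianReal]⟩
    have h : ∫ t, Real.sin (u * t) ∂(gaussianReal 0 1) =
        ∫ t, Real.sin (u * -t) ∂(gaussianReal 0 1) := by
      conv_lhs => rw [show gaussianReal 0 1 = (gaussianReal 0 1).map (fun x => -x) by
        rw [gaussianReal_map_neg]; simp]
      rw [integral_map (by fun_prop) (by fun_prop)]
    simp only [mul_neg, Real.sin_neg, integral_neg] at h
    simp only [mul_zero, hermiteReal_zero, eval_one, mul_one]
    linarith
  | succ k ih =>
    rw [show 2 * (k + 1) = 2 * k + 1 + 1 by ring, integral_sin_mul_hermiteReal_succ,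
      integral_cos_mul_hermiteReal_succ, integral_cos_mul_hermiteReal_succ,
      integral_sin_mul_hermiteReal_succ, ih.1, ih.2]
    exact ⟨by simp, by ring⟩

lemma integral_sin_mul_hermiteReal_even (u : ℝ) (k : ℕ) :
    ∫ t, Real.sin (u * t) * (hermiteReal (2 * k)).eval t ∂(gaussianReal 0 1) = 0 :=
  (integral_sin_cos_mul_hermiteReal_two_mul u k).1

lemma integral_sin_mul_hermiteReal_odd (u : ℝ) (k : ℕ) :
    ∫ t, Real.sin (u * t) * (hermiteReal (2 * k + 1)).eval t ∂(gaussianReal 0 1) =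
      (-1) ^ k * (u ^ (2 * k + 1) * Real.exp (-u ^ 2 / 2)) := by
  rw [integral_sin_mul_hermiteReal_succ, (integral_sin_cos_mul_hermiteReal_two_mul u k).2]
  ring

/-! ### The sigmoid as a sine transform -/

lemma HasSum.congr_of_eq {α : Type*} [AddCommMonoid α] [TopologicalSpace α] {f g : ℕ → α} {a b : α}
    (h : HasSum f a) (hfg : ∀ n, g n = f n) (hab : b = a) : HasSum g b := by
  rw [funext hfg, hab]; exact h

/-- The Mittag-Leffler expansion of π cot(πx) on the imaginary axis, at x = iy/π. -/
lemma hasSum_coth {y : ℝ} (hy : y ≠ 0) :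
    HasSum (fun n : ℕ => 2 * y / (y ^ 2 + (((n : ℝ) + 1) * Real.pi) ^ 2))
      (Real.cosh y / Real.sinh y - 1 / y) := by
  have hpi : (Real.pi : ℂ) ≠ 0 := by exact_mod_cast Real.pi_ne_zero
  have hy' : (y : ℂ) ≠ 0 := by exact_mod_cast hy
  set x : ℂ := Complex.I * y / Real.pi with hx
  have hxc : x ∈ Complex.integerComplement := by
    rintro ⟨n, hn⟩
    have h1 : (Complex.I * y) = (n : ℂ) * Real.pi := by
      rw [hn, hx]; field_simp
    have h2 := congrArg Complex.im h1
    simp at h2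
    exact hy h2
  have hs := cot_series_rep' hxc
  have hsum : HasSum (fun n : ℕ => (1 / (x - (n + 1)) + 1 / (x + (n + 1))))
      (Real.pi * Complex.cot (Real.pi * x) - 1 / x) := by
    rw [hs]
    exact (summable_cotTerm hxc).hasSum
  have hsum' := hsum.mul_left (Complex.I / Real.pi)
  rw [← Complex.hasSum_ofReal]
  refine hsum'.congr_of_eq (fun n => ?_) ?_
  · have h1 : x - (n + 1) ≠ 0 := by
      simpa [sub_eq_add_neg] using Complex.integerComplement_add_ne_zero hxc (-((n : ℤ) + 1))
    have h2 : x + (n + 1) ≠ 0 := by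
      simpa using Complex.integerComplement_add_ne_zero hxc ((n : ℤ) + 1)
    have h3 : ((y : ℂ) ^ 2 + (((n : ℂ) + 1) * Real.pi) ^ 2) ≠ 0 := by
      have : 0 < y ^ 2 + (((n : ℝ) + 1) * Real.pi) ^ 2 := by positivity
      exact_mod_cast this.ne'
    have h4 : ((y : ℂ) ^ 2 + (((n : ℂ) + 1) * Real.pi) ^ 2) =
        -(Real.pi ^ 2 * ((x - (n + 1)) * (x + (n + 1)))) := by
      rw [hx]; field_simp; ring_nf; simp
    push_cast
    rw [h4, div_add_div _ _ h1 h2, show (y : ℂ) = -Complex.I * Real.pi * x by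
      rw [hx]; field_simp; simp]
    field_simp
    ring
  · have hsy : Real.sinh y ≠ 0 := by simpa using hy
    have hsy' : Complex.sinh y ≠ 0 := by exact_mod_cast hsy
    rw [show (Real.pi : ℂ) * x = y * Complex.I by rw [hx]; field_simp, Complex.cot,
      Complex.cos_mul_I, Complex.sin_mul_I, hx]
    push_cast
    field_simp

/-- This is σ(2r) - 1/2 = tanh(r)/2 with tanh r = 2 coth 2r - coth r. The poles 1/r cancel, so the
regularized coth can be used. -/
lemma sigmoid_sub_half_eq_coth {r : ℝ} (hr : r ≠ 0) :
    Real.sigmoid (2 * r) - 1 / 2 = (2 * (Real.cosh (2 * r) / Real.sinh (2 * r) - 1 / (2 * r)) -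
      (Real.cosh r / Real.sinh r - 1 / r)) / 2 := by
  have hsr : Real.sinh r ≠ 0 := by simpa using hr
  have h1 : Real.sigmoid (2 * r) - 1 / 2 = Real.sinh r / Real.cosh r / 2 := by
    have he : Real.exp (-(2 * r)) = (Real.exp r)⁻¹ * (Real.exp r)⁻¹ := by
      rw [← Real.exp_neg, ← Real.exp_add]; ring_nf
    have hz := Real.exp_pos r
    have h3 : 0 < Real.exp r + (Real.exp r)⁻¹ := by positivity
    have h4 : 0 < 1 + (Real.exp r)⁻¹ * (Real.exp r)⁻¹ := by positivity
    rw [Real.sigmoid_def, Real.sinh_eq, Real.cosh_eq, he, Real.exp_neg]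
    field_simp
    ring
  have hcr := (Real.cosh_pos r).ne'
  rw [h1, Real.cosh_two_mul, Real.sinh_two_mul]
  have := Real.cosh_sq r
  field_simp
  ring

/-- In 2 coth t - coth(t/2), the series of the second term is the part of the first with poles at
even multiples of π. Only the odd multiples survive. -/
lemma hasSum_sigmoid_sub_half {t : ℝ} (ht : t ≠ 0) :
    HasSum (fun k : ℕ => 2 * (t / (((2 * (k : ℝ) + 1) * Real.pi) ^ 2 + t ^ 2)))
      (Real.sigmoid t - 1 / 2) := by
  obtain ⟨a, ha⟩ : ∃ a : ℕ → ℝ, ∀ n, a n =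
      2 * (2 * t / (t ^ 2 + (((n : ℝ) + 1) * Real.pi) ^ 2)) := ⟨_, fun _ => rfl⟩
  have hA : HasSum a (2 * (Real.cosh t / Real.sinh t - 1 / t)) :=
    ((hasSum_coth ht).mul_left 2).congr_of_eq ha rfl
  have hE : Summable (fun k => a (2 * k)) :=
    hA.summable.comp_injective (i := fun k : ℕ => 2 * k) (fun a b h => by simpa using h)
  have hB : HasSum (fun k => a (2 * k + 1))
      (Real.cosh (t / 2) / Real.sinh (t / 2) - 1 / (t / 2)) := by
    refine (hasSum_coth (y := t / 2) (by positivity)).congr_of_eq (fun k => ?_) rfl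
    rw [ha]
    push_cast
    rw [← mul_div_assoc, div_eq_div_iff (by positivity) (by positivity)]
    ring
  have hu := (hE.hasSum.even_add_odd hB).unique hA
  refine (hE.hasSum.div_const 2).congr_of_eq (fun k => ?_) ?_
  · rw [ha]
    push_cast
    rw [add_comm (t ^ 2)]
    ring
  · rw [eq_sub_of_add_eq hu]
    have := sigmoid_sub_half_eq_coth (r := t / 2) (by positivity)
    rwa [mul_div_cancel₀ t two_ne_zero] at this

lemma integrableOn_mul_exp_neg {s : ℝ} (hs : 0 < s) :
    IntegrableOn (fun u : ℝ => u * Real.exp (-(s * u))) (Set.Ioi 0) := by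
  have := integrableOn_rpow_mul_exp_neg_mul_rpow (s := 1) (p := 1) (b := s) (by norm_num)
    one_pos hs
  simpa using this

lemma integral_mul_exp_neg {s : ℝ} (hs : 0 < s) :
    ∫ u in Set.Ioi (0 : ℝ), u * Real.exp (-(s * u)) = 1 / s ^ 2 := by
  have := Real.integral_rpow_mul_exp_neg_mul_Ioi (a := 2) (r := s) (by norm_num) hs
  norm_num at this
  simpa using this

lemma abs_sin_mul_exp_neg_le (t s : ℝ) {u : ℝ} (hu : 0 < u) :
    |Real.sin (t * u) * Real.exp (-(s * u))| ≤ |t| * (u * Real.exp (-(s * u))) := by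
  rw [abs_mul, Real.abs_exp, ← mul_assoc]
  gcongr
  calc |Real.sin (t * u)| ≤ |t * u| := Real.abs_sin_le_abs
    _ = |t| * u := by rw [abs_mul, abs_of_pos hu]

lemma integrableOn_sin_mul_exp_neg (t : ℝ) {s : ℝ} (hs : 0 < s) :
    IntegrableOn (fun u : ℝ => Real.sin (t * u) * Real.exp (-(s * u))) (Set.Ioi 0) :=
  ((integrableOn_mul_exp_neg hs).const_mul |t|).mono'
    (by fun_prop) ((ae_restrict_mem measurableSet_Ioi).mono fun _ hu =>
      abs_sin_mul_exp_neg_le t s hu)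

lemma integral_sin_mul_exp_neg (t : ℝ) {s : ℝ} (hs : 0 < s) :
    ∫ u in Set.Ioi (0 : ℝ), Real.sin (t * u) * Real.exp (-(s * u)) = t / (s ^ 2 + t ^ 2) := by
  have hst : s ^ 2 + t ^ 2 ≠ 0 := by positivity
  have hd : ∀ u ∈ Set.Ici (0 : ℝ), HasDerivAt (fun u : ℝ =>
      -((s * Real.sin (t * u) + t * Real.cos (t * u)) / (s ^ 2 + t ^ 2)) * Real.exp (-(s * u)))
      (Real.sin (t * u) * Real.exp (-(s * u))) u := fun u _ => by
    have h1 : HasDerivAt (fun u : ℝ => t * u) t u := by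
      simpa using (hasDerivAt_id u).const_mul t
    have h2 : HasDerivAt (fun u : ℝ => -(s * u)) (-s) u := by
      simpa [neg_mul] using (hasDerivAt_id u).const_mul (-s)
    refine (((((h1.sin.const_mul s).add (h1.cos.const_mul t)).div_const _).neg).mul
      h2.exp).congr_deriv ?_
    simp only [Pi.neg_apply, Pi.add_apply]
    field_simp
    ring
  have hlim : Tendsto (fun u : ℝ => -((s * Real.sin (t * u) + t * Real.cos (t * u)) /
      (s ^ 2 + t ^ 2)) * Real.exp (-(s * u))) atTop (𝓝 0) := by
    refine bdd_le_mul_tendsto_zero' ((|s| + |t|) / (s ^ 2 + t ^ 2))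
      (Eventually.of_forall fun u => ?_) ?_
    · rw [abs_neg, abs_div, abs_of_pos (by positivity : 0 < s ^ 2 + t ^ 2)]
      gcongr
      refine (abs_add_le _ _).trans ?_
      rw [abs_mul, abs_mul]
      exact add_le_add (mul_le_of_le_one_right (abs_nonneg _) (Real.abs_sin_le_one _))
        (mul_le_of_le_one_right (abs_nonneg _) (Real.abs_cos_le_one _))
    · exact Real.tendsto_exp_neg_atTop_nhds_zero.comp (tendsto_id.const_mul_atTop hs)
  rw [integral_Ioi_of_hasDerivAt_of_tendsto' hd (integrableOn_sin_mul_exp_neg t hs) hlim]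
  simp

lemma hasSum_inv_sinh {x : ℝ} (hx : 0 < x) :
    HasSum (fun k : ℕ => 2 * Real.exp (-((2 * (k : ℝ) + 1) * x))) (Real.sinh x)⁻¹ := by
  have h1 : Real.exp (-(2 * x)) < 1 := by rw [Real.exp_lt_one_iff]; linarith
  have h := (hasSum_geometric_of_lt_one (Real.exp_pos _).le h1).mul_left (2 * Real.exp (-x))
  refine h.congr_of_eq (fun k => ?_) ?_
  · rw [← Real.exp_nat_mul, mul_assoc, ← Real.exp_add]
    ring_nf
  · have he : Real.exp (-(2 * x)) = Real.exp (-x) * Real.exp (-x) := by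
      rw [← Real.exp_add]; ring_nf
    rw [Real.sinh_eq, he, Real.exp_neg]
    rw [he, Real.exp_neg] at h1
    have hp := Real.exp_pos x
    set z := Real.exp x
    have hz : z ^ 2 - 1 ≠ 0 := by
      intro h
      have : z * z = 1 := by linarith
      rw [← mul_inv, this] at h1
      simp at h1
    rw [show 1 - z⁻¹ * z⁻¹ = (z ^ 2 - 1) * (z⁻¹ * z⁻¹) by field_simp,
      show z - z⁻¹ = (z ^ 2 - 1) * z⁻¹ by field_simp]
    field_simp

/-- Expanding 1/sinh(πu) as a geometric series in e^{-(2k+1)πu} turns the integral into Laplace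
transforms of the sine, which are the partial fractions of the sigmoid. Since |sin(tu)| ≤ |t|u, the
k-th term has L¹ norm O(k⁻²), which justifies the exchange. -/
lemma integral_sin_div_sinh (t : ℝ) :
    ∫ u in Set.Ioi (0 : ℝ), Real.sin (t * u) * (Real.sinh (Real.pi * u))⁻¹ =
      Real.sigmoid t - 1 / 2 := by
  rcases eq_or_ne t 0 with rfl | ht
  · simp
  have hs : ∀ k : ℕ, 0 < (2 * (k : ℝ) + 1) * Real.pi := fun k => by positivity
  have key := hasSum_integral_of_summable_integral_norm (μ := volume.restrict (Set.Ioi (0 : ℝ)))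
    (F := fun (k : ℕ) (u : ℝ) =>
      2 * (Real.sin (t * u) * Real.exp (-((2 * (k : ℝ) + 1) * Real.pi * u))))
    (fun k => (integrableOn_sin_mul_exp_neg t (hs k)).const_mul 2) ?_
  · simp_rw [integral_const_mul, integral_sin_mul_exp_neg t (hs _)] at key
    rw [(hasSum_sigmoid_sub_half ht).unique key]
    refine setIntegral_congr_fun measurableSet_Ioi fun u hu => ?_
    have := (hasSum_inv_sinh (mul_pos Real.pi_pos hu)).mul_left (Real.sin (t * u))
    rw [← this.tsum_eq]
    refine tsum_congr fun k => ?_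
    rw [← mul_assoc _ Real.pi u]
    ring
  · refine Summable.of_nonneg_of_le (f := fun k : ℕ => 2 * |t| * (1 / ((k : ℝ) + 1) ^ 2))
      (fun k => integral_nonneg fun _ => norm_nonneg _) (fun k => ?_) ?_
    · calc _ ≤ ∫ u in Set.Ioi (0 : ℝ),
            2 * (|t| * (u * Real.exp (-((2 * (k : ℝ) + 1) * Real.pi * u)))) := by
            refine setIntegral_mono_on
              ((integrableOn_sin_mul_exp_neg t (hs k)).const_mul 2).norm
              (((integrableOn_mul_exp_neg (hs k)).const_mul |t|).const_mul 2)
              measurableSet_Ioi fun u hu => ?_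
            rw [norm_mul, Real.norm_ofNat, Real.norm_eq_abs]
            gcongr
            exact abs_sin_mul_exp_neg_le t _ hu
        _ = 2 * |t| * (1 / ((2 * (k : ℝ) + 1) * Real.pi) ^ 2) := by
            rw [integral_const_mul, integral_const_mul, integral_mul_exp_neg (hs k), mul_assoc]
        _ ≤ _ := by
            gcongr
            nlinarith [Real.pi_gt_three, (Nat.cast_nonneg k : (0 : ℝ) ≤ k)]
    · refine Summable.mul_left _ ?_
      have := (summable_nat_add_iff 1).mpr (Real.summable_one_div_nat_pow.mpr one_lt_two)
      simpa using this

/-! ### The Hermite coefficients of the sigmoid -/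

/-- The factor u cancels the pole of 1/sinh at 0. Decay rate 1 in place of π is enough for every
later use. -/
lemma div_sinh_le {u : ℝ} (hu : 0 < u) : u * (Real.sinh (Real.pi * u))⁻¹ ≤ 2 * Real.exp (-u) := by
  have hx : 0 < Real.pi * u := by positivity
  have hs : 0 < Real.sinh (Real.pi * u) := Real.sinh_pos_iff.mpr hx
  rw [← div_eq_mul_inv, div_le_iff₀ hs, Real.sinh_eq]
  have h1 : 1 + (Real.pi * u - u) ≤ Real.exp (Real.pi * u - u) := by
    linarith [Real.add_one_le_exp (Real.pi * u - u)]
  have h2 : Real.exp (-u) * Real.exp (Real.pi * u) = Real.exp (Real.pi * u - u) := by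
    rw [← Real.exp_add]; ring_nf
  have h3 : Real.exp (-u) * Real.exp (-(Real.pi * u)) ≤ 1 := by
    rw [← Real.exp_add, Real.exp_le_one_iff]; linarith
  have := Real.pi_gt_three
  nlinarith

lemma integrableOn_div_sinh :
    IntegrableOn (fun u : ℝ => u * (Real.sinh (Real.pi * u))⁻¹) (Set.Ioi 0) := by
  have h1 : IntegrableOn (fun u : ℝ => 2 * Real.exp (-u)) (Set.Ioi 0) :=
    (integrableOn_exp_neg_Ioi 0).const_mul 2
  have hm : Measurable fun u : ℝ => u * (Real.sinh (Real.pi * u))⁻¹ :=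
    measurable_id.mul (Real.continuous_sinh.measurable.comp (measurable_const.mul measurable_id)).inv
  refine h1.mono' hm.aestronglyMeasurable
    ((ae_restrict_mem measurableSet_Ioi).mono fun u hu => ?_)
  rw [Real.norm_of_nonneg]
  · exact div_sinh_le hu
  · exact mul_nonneg (le_of_lt hu)
      (inv_nonneg.mpr (Real.sinh_nonneg_iff.mpr (mul_pos Real.pi_pos hu).le))

lemma integral_hermiteReal_eq_zero {n : ℕ} (hn : n ≠ 0) :
    ∫ t, (hermiteReal n).eval t ∂(gaussianReal 0 1) = 0 := by
  have := integral_hermiteReal_mul_of_ne hn.symm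
  simpa [hermiteReal_zero] using this

lemma integrable_sigmoid_mul_eval (p : ℝ[X]) :
    Integrable (fun t => Real.sigmoid t * p.eval t) (gaussianReal 0 1) :=
  integrable_bdd_mul_eval continuous_sigmoid (c := 1) (fun t => by
    rw [abs_of_nonneg (Real.sigmoid_nonneg t)]; exact Real.sigmoid_le_one t) p

lemma integral_sigmoid_mul_hermiteReal {n : ℕ} (hn : n ≠ 0) :
    ∫ t, Real.sigmoid t * (hermiteReal n).eval t ∂(gaussianReal 0 1) =
      ∫ t, (Real.sigmoid t - 1 / 2) * (hermiteReal n).eval t ∂(gaussianReal 0 1) := by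
  simp_rw [sub_mul]
  rw [integral_sub (integrable_sigmoid_mul_eval _)
    ((integrable_eval_gaussianReal _).const_mul _), integral_const_mul,
    integral_hermiteReal_eq_zero hn, mul_zero, sub_zero]

/-- Fubini. The bound |sin(ut)| ≤ u|t| supplies the factor u that makes 1/sinh(πu) integrable at 0;
the factor |t| is absorbed by the Gaussian moments. -/
lemma integral_sigmoid_mul_hermiteReal_eq_sine {n : ℕ} (hn : n ≠ 0) :
    ∫ t, Real.sigmoid t * (hermiteReal n).eval t ∂(gaussianReal 0 1) =
      ∫ u in Set.Ioi (0 : ℝ), (∫ t, Real.sin (u * t) * (hermiteReal n).eval t ∂(gaussianReal 0 1)) *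
        (Real.sinh (Real.pi * u))⁻¹ := by
  rw [integral_sigmoid_mul_hermiteReal hn]
  simp_rw [← integral_sin_div_sinh, ← integral_mul_const]
  rw [integral_integral_swap]
  · congr 1; ext u; congr 1; ext t
    rw [mul_comm t u]; ring
  · have h1 : Integrable (fun t : ℝ => t * (hermiteReal n).eval t) (gaussianReal 0 1) := by
      refine (integrable_eval_gaussianReal (X * hermiteReal n)).congr
        (Eventually.of_forall fun t => ?_)
      simp only [eval_mul, eval_X]
    have h2 := h1.norm.mul_prod integrableOn_div_sinh
    refine h2.mono' ?_ ?_
    · refine Measurable.aestronglyMeasurable ?_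
      have hm : Measurable fun u : ℝ => (Real.sinh (Real.pi * u))⁻¹ :=
        (Real.continuous_sinh.measurable.comp (measurable_const.mul measurable_id)).inv
      exact ((Real.measurable_sin.comp (measurable_fst.mul measurable_snd)).mul
        (hm.comp measurable_snd)).mul ((hermiteReal n).continuous.measurable.comp measurable_fst)
    · have hae : ∀ᵐ z ∂((gaussianReal 0 1).prod (volume.restrict (Set.Ioi (0 : ℝ)))),
          z.2 ∈ Set.Ioi (0 : ℝ) :=
        Measure.quasiMeasurePreserving_snd.ae (ae_restrict_mem measurableSet_Ioi)
      filter_upwards [hae] with z hz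
      have hs : 0 < (Real.sinh (Real.pi * z.2))⁻¹ :=
        inv_pos.mpr (Real.sinh_pos_iff.mpr (mul_pos Real.pi_pos hz))
      simp only [Function.uncurry, norm_mul, Real.norm_eq_abs, abs_of_pos hs]
      calc _ ≤ |z.1 * z.2| * (Real.sinh (Real.pi * z.2))⁻¹ * |(hermiteReal n).eval z.1| := by
            gcongr ?_ * _ * _; exact Real.abs_sin_le_abs
        _ = _ := by rw [abs_mul, abs_of_pos (show (0 : ℝ) < z.2 from hz)]; ring

lemma hermiteCoeff_eq (f : ℝ → ℝ) (n : ℕ) : hermiteCoeff f n =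
    (∫ t, f t * (hermiteReal n).eval t ∂(gaussianReal 0 1)) / √(n.factorial : ℝ) := by
  rw [hermiteCoeff, ← integral_div]
  congr 1; ext t
  rw [aeval_hermite_eq_eval, mul_div_assoc]

lemma hermiteCoeff_sigmoid_even {n : ℕ} (hn : n ≠ 0) (he : Even n) :
    hermiteCoeff Real.sigmoid n = 0 := by
  obtain ⟨k, rfl⟩ := even_iff_two_dvd.mp he
  rw [hermiteCoeff_eq, integral_sigmoid_mul_hermiteReal_eq_sine hn]
  simp [integral_sin_mul_hermiteReal_even]

lemma pow_mul_exp_div_sinh_nonneg (n : ℕ) {u : ℝ} (hu : 0 < u) :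
    0 ≤ u ^ n * Real.exp (-u ^ 2 / 2) * (Real.sinh (Real.pi * u))⁻¹ := by
  have : 0 < Real.sinh (Real.pi * u) := Real.sinh_pos_iff.mpr (mul_pos Real.pi_pos hu)
  positivity

lemma abs_hermiteCoeff_sigmoid_odd {n : ℕ} (ho : Odd n) :
    |hermiteCoeff Real.sigmoid n| = (∫ u in Set.Ioi (0 : ℝ),
      u ^ n * Real.exp (-u ^ 2 / 2) * (Real.sinh (Real.pi * u))⁻¹) / √(n.factorial : ℝ) := by
  obtain ⟨k, rfl⟩ := ho
  rw [hermiteCoeff_eq, integral_sigmoid_mul_hermiteReal_eq_sine (by omega)]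
  simp_rw [integral_sin_mul_hermiteReal_odd, mul_assoc]
  rw [integral_const_mul, abs_div, abs_mul, abs_pow, abs_neg, abs_one, one_pow, one_mul,
    abs_of_nonneg, abs_of_nonneg (Real.sqrt_nonneg _)]
  refine setIntegral_nonneg measurableSet_Ioi fun u hu => ?_
  simpa [mul_assoc] using pow_mul_exp_div_sinh_nonneg (2 * k + 1) hu

/-- `uᵏ e^{-u²/2}` is at most its maximum times a Gaussian centred at the maximizer `√k`. -/
lemma pow_mul_exp_le (k : ℕ) {u : ℝ} (hu : 0 < u) :
    u ^ k * Real.exp (-u ^ 2 / 2) ≤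
      √(k.factorial : ℝ) * Real.exp (-(u - √(k : ℝ)) ^ 2 / 2) := by
  rcases Nat.eq_zero_or_pos k with rfl | hk
  · simp
  have hk' : (0 : ℝ) < k := by exact_mod_cast hk
  set s := √(k : ℝ) with hs
  have hs0 : 0 < s := Real.sqrt_pos.mpr hk'
  have hss : s ^ 2 = k := Real.sq_sqrt hk'.le
  -- The inequality r ≤ e^{r-1} at r = u/s, raised to the power k = s²; the remaining exponents
  -- complete a square centred at s.
  have h1 : (u / s) ^ k ≤ Real.exp (s * u - s ^ 2) := by
    calc (u / s) ^ k ≤ Real.exp (u / s - 1) ^ k := by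
          gcongr; linarith [Real.add_one_le_exp (u / s - 1)]
      _ = _ := by
          rw [← Real.exp_nat_mul, ← hss]; congr 1; field_simp
  have h2 : s ^ k * Real.exp (-s ^ 2 / 2) ≤ √(k.factorial : ℝ) := by
    apply Real.le_sqrt_of_sq_le
    have h3 : (k : ℝ) ^ k / k.factorial ≤ Real.exp k := Real.pow_div_factorial_le_exp _ hk'.le k
    rw [mul_pow, ← pow_mul, mul_comm k, pow_mul, hss, ← Real.exp_nat_mul, ← hss]
    rw [div_le_iff₀ (by positivity)] at h3
    rw [show ((2 : ℕ) : ℝ) * (-s ^ 2 / 2) = -s ^ 2 by push_cast; ring, Real.exp_neg, hss,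
      ← div_eq_mul_inv, div_le_iff₀ (Real.exp_pos _)]
    linarith
  calc u ^ k * Real.exp (-u ^ 2 / 2) = (u / s) ^ k * (s ^ k * Real.exp (-u ^ 2 / 2)) := by
        rw [div_pow]; field_simp
    _ ≤ Real.exp (s * u - s ^ 2) * (s ^ k * Real.exp (-u ^ 2 / 2)) := by gcongr
    _ = (s ^ k * Real.exp (-s ^ 2 / 2)) * Real.exp (-(u - s) ^ 2 / 2) := by
        rw [mul_left_comm, mul_assoc, ← Real.exp_add, ← Real.exp_add]; ring_nf
    _ ≤ _ := by gcongr

lemma integrableOn_pow_mul_exp_div_sinh {n : ℕ} (hn : n ≠ 0) :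
    IntegrableOn (fun u : ℝ =>
      u ^ n * Real.exp (-u ^ 2 / 2) * (Real.sinh (Real.pi * u))⁻¹) (Set.Ioi 0) := by
  obtain ⟨k, rfl⟩ := Nat.exists_eq_succ_of_ne_zero hn
  have hm : Measurable fun u : ℝ => (Real.sinh (Real.pi * u))⁻¹ :=
    (Real.continuous_sinh.measurable.comp (measurable_const.mul measurable_id)).inv
  refine (integrableOn_div_sinh.const_mul √(k.factorial : ℝ)).mono'
    ((by fun_prop : Measurable fun u : ℝ => u ^ (k + 1) * Real.exp (-u ^ 2 / 2)).mul
      hm).aestronglyMeasurable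
    ((ae_restrict_mem measurableSet_Ioi).mono fun u hu => ?_)
  rw [Real.norm_of_nonneg (pow_mul_exp_div_sinh_nonneg _ hu)]
  calc _ = (u ^ k * Real.exp (-u ^ 2 / 2)) * (u * (Real.sinh (Real.pi * u))⁻¹) := by
        rw [Nat.succ_eq_add_one]; ring
    _ ≤ _ := by
        refine mul_le_mul_of_nonneg_right ((pow_mul_exp_le k hu).trans ?_) ?_
        · refine mul_le_of_le_one_right (Real.sqrt_nonneg _) (Real.exp_le_one_iff.mpr ?_)
          have := sq_nonneg (u - √(k : ℝ))
          linarith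
        · exact mul_nonneg (le_of_lt hu)
            (inv_nonneg.mpr (Real.sinh_nonneg_iff.mpr (mul_pos Real.pi_pos hu).le))

lemma integrable_gaussian_shift (c : ℝ) :
    Integrable (fun u : ℝ => Real.exp (-(u - c) ^ 2 / 2)) := by
  have h := (integrable_exp_neg_mul_sq (b := 1 / 2) (by norm_num)).comp_sub_right c
  refine h.congr (Eventually.of_forall fun u => ?_)
  simp only; ring_nf

lemma integral_gaussian_shift (c : ℝ) :
    ∫ u : ℝ, Real.exp (-(u - c) ^ 2 / 2) = √(2 * Real.pi) := by
  have h := integral_gaussian (1 / 2)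
  rw [← integral_sub_right_eq_self _ c] at h
  convert h using 1
  · congr 1; ext u; ring_nf
  · congr 1; field_simp

/-- With n = k + 1, one factor u goes to tame 1/sinh and leaves 2e^{-u}; the rest is a Gaussian bump
centred at s = √k. Completing the square in the product moves the centre to s - 1 and produces
e^{1/2-s}. -/
lemma exists_abs_hermiteCoeff_sigmoid_le :
    ∃ K : ℝ, 1 ≤ K ∧ ∀ n : ℕ, 1 ≤ n →
      |hermiteCoeff Real.sigmoid n| ≤ K * Real.exp (-√(n : ℝ)) := by
  refine ⟨max 1 (2 * Real.exp (1 / 2) * √(2 * Real.pi) * Real.exp 1), le_max_left _ _,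
    fun n hn => ?_⟩
  refine le_trans ?_ (mul_le_mul_of_nonneg_right (le_max_right _ _) (Real.exp_pos _).le)
  rcases Nat.even_or_odd n with he | ho
  · rw [hermiteCoeff_sigmoid_even (by omega) he, abs_zero]; positivity
  rw [abs_hermiteCoeff_sigmoid_odd ho]
  obtain ⟨k, rfl⟩ : ∃ k, n = k + 1 := ⟨n - 1, by omega⟩
  set s := √(k : ℝ) with hs
  have hbound : ∀ u ∈ Set.Ioi (0 : ℝ),
      u ^ (k + 1) * Real.exp (-u ^ 2 / 2) * (Real.sinh (Real.pi * u))⁻¹ ≤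
      (2 * Real.exp (1 / 2) * Real.exp (-s) * √(k.factorial : ℝ)) *
        Real.exp (-(u - (s - 1)) ^ 2 / 2) := fun u hu => by
    calc _ = (u ^ k * Real.exp (-u ^ 2 / 2)) * (u * (Real.sinh (Real.pi * u))⁻¹) := by ring
      _ ≤ (√(k.factorial : ℝ) * Real.exp (-(u - s) ^ 2 / 2)) * (2 * Real.exp (-u)) := by
          refine mul_le_mul (pow_mul_exp_le k hu) (div_sinh_le hu) ?_ (by positivity)
          simpa using (mul_nonneg (le_of_lt hu)
            (inv_nonneg.mpr (Real.sinh_nonneg_iff.mpr (mul_pos Real.pi_pos hu).le)))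
      _ = 2 * √(k.factorial : ℝ) * (Real.exp (-(u - s) ^ 2 / 2) * Real.exp (-u)) := by ring
      _ = 2 * √(k.factorial : ℝ) *
          (Real.exp (1 / 2) * Real.exp (-s) * Real.exp (-(u - (s - 1)) ^ 2 / 2)) := by
          simp_rw [← Real.exp_add]; ring_nf
      _ = _ := by ring
  have hint := ((integrable_gaussian_shift (s - 1)).const_mul
    (2 * Real.exp (1 / 2) * Real.exp (-s) * √(k.factorial : ℝ)))
  have hI : ∫ u in Set.Ioi (0 : ℝ),
      u ^ (k + 1) * Real.exp (-u ^ 2 / 2) * (Real.sinh (Real.pi * u))⁻¹ ≤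
      (2 * Real.exp (1 / 2) * Real.exp (-s) * √(k.factorial : ℝ)) * √(2 * Real.pi) := by
    rw [← integral_gaussian_shift (s - 1), ← integral_const_mul]
    refine le_trans (integral_mono_of_nonneg ?_ hint.integrableOn ?_)
      (setIntegral_le_integral hint (Eventually.of_forall fun u => by positivity))
    · exact (ae_restrict_mem measurableSet_Ioi).mono fun u hu => pow_mul_exp_div_sinh_nonneg _ hu
    · exact (ae_restrict_mem measurableSet_Ioi).mono hbound
  have hf : √(k.factorial : ℝ) ≤ √((k + 1).factorial : ℝ) :=
    Real.sqrt_le_sqrt (by exact_mod_cast Nat.factorial_le (Nat.le_succ k))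
  have hexp : Real.exp (-s) ≤ Real.exp 1 * Real.exp (-√((k + 1 : ℕ) : ℝ)) := by
    rw [← Real.exp_add, Real.exp_le_exp]
    have h2 : √((k + 1 : ℕ) : ℝ) ≤ s + 1 := by
      refine Real.sqrt_le_iff.mpr ⟨by positivity, ?_⟩
      have := Real.sq_sqrt (Nat.cast_nonneg k : (0 : ℝ) ≤ k)
      push_cast
      nlinarith [Real.sqrt_nonneg (k : ℝ)]
    linarith
  rw [div_le_iff₀ (by positivity)]
  refine hI.trans ?_
  calc _ = (2 * Real.exp (1 / 2) * √(2 * Real.pi)) * Real.exp (-s) * √(k.factorial : ℝ) := by ring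
    _ ≤ (2 * Real.exp (1 / 2) * √(2 * Real.pi)) *
        (Real.exp 1 * Real.exp (-√((k + 1 : ℕ) : ℝ))) * √((k + 1).factorial : ℝ) := by gcongr
    _ = _ := by ring

/-- Uses |σ - 1/2| ≤ 1/2 and |y| ≤ (1 + y²)/2 for the normalized Hermite value y. A bound strictly
below 1 for small n is what allows the multiplicative constant in the decay estimate to be removed.
-/
lemma abs_hermiteCoeff_sigmoid_le_half {n : ℕ} (hn : n ≠ 0) :
    |hermiteCoeff Real.sigmoid n| ≤ 1 / 2 := by
  have hpos : (0 : ℝ) < n.factorial := by exact_mod_cast n.factorial_pos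
  rw [hermiteCoeff_eq, integral_sigmoid_mul_hermiteReal hn, ← integral_div]
  have h1 : Integrable (fun t => (hermiteReal n).eval t * (hermiteReal n).eval t)
      (gaussianReal 0 1) := by
    simpa using integrable_eval_gaussianReal (hermiteReal n * hermiteReal n)
  have h2 := ((integrable_const (1 : ℝ)).add (h1.div_const (n.factorial : ℝ))).div_const 4
  calc _ ≤ ∫ t, |(Real.sigmoid t - 1 / 2) * (hermiteReal n).eval t / √(n.factorial : ℝ)|
        ∂(gaussianReal 0 1) := abs_integral_le_integral_abs
    _ ≤ ∫ t, (1 + (hermiteReal n).eval t * (hermiteReal n).eval t / n.factorial) / 4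
        ∂(gaussianReal 0 1) := by
        refine integral_mono_of_nonneg (Eventually.of_forall fun t => abs_nonneg _) h2
          (Eventually.of_forall fun t => ?_)
        simp only
        rw [mul_div_assoc, abs_mul]
        set y := (hermiteReal n).eval t / √(n.factorial : ℝ) with hy
        have hyy : (hermiteReal n).eval t * (hermiteReal n).eval t / n.factorial = |y| ^ 2 := by
          rw [sq_abs, hy, div_pow, Real.sq_sqrt hpos.le, sq]
        have hg : |Real.sigmoid t - 1 / 2| ≤ 1 / 2 := by
          rw [abs_le]; constructor <;> linarith [Real.sigmoid_nonneg t, Real.sigmoid_le_one t]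
        rw [hyy]
        nlinarith [abs_nonneg y, sq_nonneg (|y| - 1)]
    _ = 1 / 2 := by
        rw [integral_div, integral_add (integrable_const _) (h1.div_const _), integral_div,
          integral_hermiteReal_mul_self, div_self hpos.ne']
        norm_num

lemma exists_abs_hermiteCoeff_sigmoid_le_exp :
    ∃ a : ℝ, 0 < a ∧ ∀ n : ℕ, 1 ≤ n →
      |hermiteCoeff Real.sigmoid n| ≤ Real.exp (-(a * √(n : ℝ))) := by
  obtain ⟨K, hK, h⟩ := exists_abs_hermiteCoeff_sigmoid_le
  have hl : 0 ≤ Real.log K := Real.log_nonneg hK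
  have hl2 : 0 < Real.log 2 := Real.log_pos one_lt_two
  set M := 2 * Real.log K + 1 with hM
  have hM0 : 0 < M := by positivity
  -- When √n ≥ M, half of the decay pays for K. When √n ≤ M, the bound 1/2 = e^{-log 2} is enough.
  refine ⟨min (1 / 2) (Real.log 2 / M), by positivity, fun n hn => ?_⟩
  have hs := Real.sqrt_nonneg (n : ℝ)
  rcases le_total M (√(n : ℝ)) with hc | hc
  · refine (h n hn).trans ?_
    rw [← Real.exp_log (by linarith : 0 < K), ← Real.exp_add, Real.exp_le_exp]
    have := mul_le_mul_of_nonneg_right (min_le_left (1 / 2) (Real.log 2 / M)) hs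
    linarith
  · refine (abs_hermiteCoeff_sigmoid_le_half (by omega)).trans ?_
    have : min (1 / 2) (Real.log 2 / M) * √(n : ℝ) ≤ Real.log 2 / M * M := by
      gcongr
      exact min_le_right _ _
    rw [div_mul_cancel₀ _ hM0.ne'] at this
    calc (1 / 2 : ℝ) = Real.exp (-Real.log 2) := by rw [Real.exp_neg, Real.exp_log two_pos]; simp
      _ ≤ _ := Real.exp_le_exp.mpr (by linarith)

/-- The Stirling sequence is decreasing, so it is at most its value e/√2 at 1. -/
lemma factorial_le_exp_mul {n : ℕ} (hn : n ≠ 0) :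
    (n.factorial : ℝ) ≤ Real.exp 1 * √(n : ℝ) * (n / Real.exp 1) ^ n := by
  obtain ⟨k, rfl⟩ := Nat.exists_eq_succ_of_ne_zero hn
  have h := Stirling.stirlingSeq'_antitone (Nat.zero_le k)
  simp only [Function.comp_apply, Stirling.stirlingSeq_one] at h
  rw [Stirling.stirlingSeq, div_le_iff₀ (by positivity)] at h
  refine h.trans (le_of_eq ?_)
  rw [Real.sqrt_mul zero_le_two]
  field_simp

/-- Only the window [s, s+1] with s = √n is kept. There uⁿ ≥ sⁿ, the Gaussian factor loses at most s
+ 1/2 in the exponent, and 1/sinh(πu) ≥ e^{-πu} loses at most 4s + 4. As s ≥ 1 this is within 10s;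
comparing √n! with sⁿ e^{-s²/2} costs one more s, hence 11. -/
lemma exp_le_abs_hermiteCoeff_sigmoid {n : ℕ} (ho : Odd n) :
    Real.exp (-(11 * √(n : ℝ))) ≤ |hermiteCoeff Real.sigmoid n| := by
  have hn : n ≠ 0 := by rintro rfl; simp at ho
  have hn1 : (1 : ℝ) ≤ n := by exact_mod_cast Nat.one_le_iff_ne_zero.mpr hn
  rw [abs_hermiteCoeff_sigmoid_odd ho, le_div_iff₀ (by positivity)]
  set s := √(n : ℝ) with hs
  have hs1 : 1 ≤ s := Real.one_le_sqrt.mpr hn1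
  have hss : s ^ 2 = n := Real.sq_sqrt (by linarith)
  have hfac : √(n.factorial : ℝ) ≤ Real.exp s * (s ^ n * Real.exp (-s ^ 2 / 2)) := by
    rw [Real.sqrt_le_iff]
    refine ⟨by positivity, (factorial_le_exp_mul hn).trans ?_⟩
    rw [mul_pow, mul_pow, ← pow_mul, mul_comm n, pow_mul, hss, ← Real.exp_nat_mul,
      ← Real.exp_nat_mul, div_pow, ← Real.exp_nat_mul, mul_one,
      show ((2 : ℕ) : ℝ) * (-(n : ℝ) / 2) = -n by push_cast; ring, Real.exp_neg,
      ← div_eq_mul_inv, ← hs]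
    gcongr
    calc Real.exp 1 * s ≤ Real.exp s * Real.exp s := by
          gcongr; linarith [Real.add_one_le_exp s]
      _ = _ := by rw [← Real.exp_add]; congr 1; push_cast; ring
  have hsub : Set.Icc s (s + 1) ⊆ Set.Ioi (0 : ℝ) := fun u hu => by
    have := hu.1; simp only [Set.mem_Ioi]; linarith
  have hpi := Real.pi_lt_four
  have hlow : ∀ u ∈ Set.Icc s (s + 1),
      s ^ n * Real.exp (-s ^ 2 / 2) * Real.exp (-(10 * s)) ≤
      u ^ n * Real.exp (-u ^ 2 / 2) * (Real.sinh (Real.pi * u))⁻¹ := fun u hu => by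
    obtain ⟨hu1, hu2⟩ := hu
    have hu0 : 0 < u := by linarith
    have hsp : 0 < Real.sinh (Real.pi * u) := Real.sinh_pos_iff.mpr (mul_pos Real.pi_pos hu0)
    have h1 : Real.exp (-(Real.pi * u)) ≤ (Real.sinh (Real.pi * u))⁻¹ := by
      rw [Real.exp_neg]
      refine inv_anti₀ hsp ?_
      rw [Real.sinh_eq]
      linarith [Real.exp_pos (Real.pi * u), Real.exp_pos (-(Real.pi * u))]
    calc _ = s ^ n * Real.exp (-s ^ 2 / 2 + -(10 * s)) := by rw [mul_assoc, Real.exp_add]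
      _ ≤ u ^ n * Real.exp (-u ^ 2 / 2 + -(Real.pi * u)) := by
          have h2 : Real.pi * u ≤ 4 * (s + 1) := by gcongr
          have h3 : u ^ 2 ≤ (s + 1) ^ 2 := by gcongr
          exact mul_le_mul (by gcongr) (Real.exp_le_exp.mpr (by nlinarith)) (Real.exp_pos _).le
            (by positivity)
      _ = u ^ n * Real.exp (-u ^ 2 / 2) * Real.exp (-(Real.pi * u)) := by
          rw [mul_assoc, Real.exp_add]
      _ ≤ _ := by gcongr
  have hint := integrableOn_pow_mul_exp_div_sinh hn
  calc Real.exp (-(11 * s)) * √(n.factorial : ℝ)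
      ≤ Real.exp (-(11 * s)) * (Real.exp s * (s ^ n * Real.exp (-s ^ 2 / 2))) := by gcongr
    _ = (s ^ n * Real.exp (-s ^ 2 / 2)) * (Real.exp (-(11 * s)) * Real.exp s) := by ring
    _ = s ^ n * Real.exp (-s ^ 2 / 2) * Real.exp (-(10 * s)) := by
        rw [← Real.exp_add]; ring_nf
    _ = ∫ u in Set.Icc s (s + 1), s ^ n * Real.exp (-s ^ 2 / 2) * Real.exp (-(10 * s)) := by
        rw [setIntegral_const]; simp
    _ ≤ ∫ u in Set.Icc s (s + 1),
        u ^ n * Real.exp (-u ^ 2 / 2) * (Real.sinh (Real.pi * u))⁻¹ := by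
        refine setIntegral_mono_on ?_ (hint.mono_set hsub) measurableSet_Icc hlow
        exact integrableOn_const (by simp)
    _ ≤ _ := setIntegral_mono_set hint
        ((ae_restrict_mem measurableSet_Ioi).mono fun u hu => pow_mul_exp_div_sinh_nonneg n hu)
        hsub.eventuallyLE

/-! ### Completeness of the Hermite polynomials and polynomial approximation -/

lemma inner_toLp_toLp {α : Type*} [MeasurableSpace α] {μ : Measure α} {f g : α → ℝ}
    (hf : MemLp f 2 μ) (hg : MemLp g 2 μ) :
    inner ℝ (hf.toLp f) (hg.toLp g) = ∫ x, f x * g x ∂μ := by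
  rw [L2.inner_def]
  refine integral_congr_ae ?_
  filter_upwards [hf.coeFn_toLp, hg.coeFn_toLp] with x h1 h2
  rw [h1, h2]
  simp [mul_comm]

lemma memLp_eval_gaussianReal (p : ℝ[X]) :
    MemLp (fun t : ℝ => p.eval t) 2 (gaussianReal 0 1) := by
  rw [memLp_two_iff_integrable_sq p.continuous.aestronglyMeasurable]
  simp_rw [← eval_pow]
  exact integrable_eval_gaussianReal _

lemma memLp_sigmoid {α : Type*} [MeasurableSpace α] (μ : Measure α) [IsFiniteMeasure μ]
    {X : α → ℝ} (hX : Measurable X) : MemLp (fun x => Real.sigmoid (X x)) 2 μ :=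
  MemLp.of_bound (continuous_sigmoid.measurable.comp hX).aestronglyMeasurable 1
    (Eventually.of_forall fun x => by
      rw [Real.norm_of_nonneg (Real.sigmoid_nonneg _)]; exact Real.sigmoid_le_one _)

/-- The normalized Hermite polynomial. -/
noncomputable def normHermite (n : ℕ) : ℝ[X] := C (√(n.factorial : ℝ))⁻¹ * hermiteReal n

lemma eval_normHermite (n : ℕ) (t : ℝ) :
    (normHermite n).eval t = (hermiteReal n).eval t / √(n.factorial : ℝ) := by
  rw [normHermite, eval_mul, eval_C, div_eq_inv_mul]

lemma natDegree_normHermite_le (n : ℕ) : (normHermite n).natDegree ≤ n :=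
  (natDegree_C_mul_le _ _).trans (natDegree_hermiteReal n).le

/-- The normalized Hermite polynomial as an element of `L²` of the Gaussian. -/
noncomputable def hermiteLp (n : ℕ) : Lp ℝ 2 (gaussianReal 0 1) :=
  (memLp_eval_gaussianReal (normHermite n)).toLp _

lemma integral_normHermite_mul (m n : ℕ) :
    ∫ t, (normHermite m).eval t * (normHermite n).eval t ∂(gaussianReal 0 1) =
      if m = n then 1 else 0 := by
  have h : ∀ t, (normHermite m).eval t * (normHermite n).eval t =
      (√(m.factorial : ℝ) * √(n.factorial : ℝ))⁻¹ *
        ((hermiteReal m).eval t * (hermiteReal n).eval t) := fun t => by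
    rw [eval_normHermite, eval_normHermite]; field_simp
  simp_rw [h]
  rw [integral_const_mul]
  split_ifs with hmn
  · subst hmn
    rw [integral_hermiteReal_mul_self, Real.mul_self_sqrt (by positivity),
      inv_mul_cancel₀ (by positivity)]
  · rw [integral_hermiteReal_mul_of_ne hmn, mul_zero]

lemma orthonormal_hermiteLp : Orthonormal ℝ hermiteLp := by
  rw [orthonormal_iff_ite]
  intro m n
  rw [hermiteLp, hermiteLp, inner_toLp_toLp, integral_normHermite_mul]

/-- The Hermite polynomials are monic of every degree, so subtracting a multiple of one lowers the
degree. -/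
lemma integral_eval_mul_eq_zero_of_hermiteReal {g : ℝ → ℝ} (hg : MemLp g 2 (gaussianReal 0 1))
    (h : ∀ n, ∫ t, (hermiteReal n).eval t * g t ∂(gaussianReal 0 1) = 0) (p : ℝ[X]) :
    ∫ t, p.eval t * g t ∂(gaussianReal 0 1) = 0 := by
  have hint : ∀ q : ℝ[X], Integrable (fun t => q.eval t * g t) (gaussianReal 0 1) := fun q =>
    (memLp_eval_gaussianReal q).integrable_mul hg
  suffices H : ∀ (n : ℕ) (p : ℝ[X]), p.degree < n →
      ∫ t, p.eval t * g t ∂(gaussianReal 0 1) = 0 by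
    refine H (p.natDegree + 1) p (degree_le_natDegree.trans_lt ?_)
    exact_mod_cast Nat.lt_succ_self _
  intro n
  induction n with
  | zero =>
    intro p hp
    have : p = 0 := by
      rw [← degree_eq_bot]; simpa [Nat.WithBot.lt_zero_iff] using hp
    simp [this]
  | succ n ih =>
    intro p hp
    have hq : (p - C (p.coeff n) * hermiteReal n).degree < n := by
      rw [degree_lt_iff_coeff_zero] at hp ⊢
      intro m hm
      rcases hm.eq_or_lt with rfl | hm
      · have := monic_hermiteReal n
        rw [Monic, leadingCoeff, natDegree_hermiteReal] at this
        simp [this]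
      · rw [coeff_sub, coeff_C_mul, hp m hm, coeff_eq_zero_of_natDegree_lt
          (p := hermiteReal n) (by rwa [natDegree_hermiteReal])]
        simp
    have h0 := ih _ hq
    have hsplit : ∀ t, p.eval t * g t = (p - C (p.coeff n) * hermiteReal n).eval t * g t +
        p.coeff n * ((hermiteReal n).eval t * g t) := fun t => by
      simp only [eval_sub, eval_mul, eval_C]; ring
    simp_rw [hsplit]
    rw [integral_add (hint _) ((hint _).const_mul _), integral_const_mul, h0, h n]
    simp

lemma memLp_exp_abs_mul (u : ℝ) :
    MemLp (fun t : ℝ => Real.exp |u * t|) 2 (gaussianReal 0 1) := by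
  have hc : Continuous fun t : ℝ => Real.exp |u * t| := by fun_prop
  rw [memLp_two_iff_integrable_sq hc.aestronglyMeasurable]
  refine ((integrable_exp_mul_gaussianReal (2 * u)).add
    (integrable_exp_mul_gaussianReal (-(2 * u)))).mono' (hc.pow 2).aestronglyMeasurable
    (Eventually.of_forall fun t => ?_)
  rw [Real.norm_of_nonneg (by positivity), ← Real.exp_nat_mul]
  simp only [Pi.add_apply]
  rcases abs_cases (u * t) with ⟨h, _⟩ | ⟨h, _⟩ <;> rw [h]
  · refine le_trans (le_of_eq ?_) (le_add_of_nonneg_right (Real.exp_pos _).le)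
    push_cast; ring_nf
  · refine le_trans (le_of_eq ?_) (le_add_of_nonneg_left (Real.exp_pos _).le)
    push_cast; ring_nf

/-- A square-integrable function orthogonal to the polynomials has vanishing Fourier transform. -/
lemma integral_cexp_mul_eq_zero {g : ℝ → ℝ} (hg : MemLp g 2 (gaussianReal 0 1))
    (h : ∀ p : ℝ[X], ∫ t, p.eval t * g t ∂(gaussianReal 0 1) = 0) (u : ℝ) :
    ∫ t, Complex.exp (u * t * Complex.I) * g t ∂(gaussianReal 0 1) = 0 := by
  have hbound : ∀ t : ℝ, HasSum (fun k : ℕ => |u * t| ^ k / k.factorial * |g t|)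
      (Real.exp |u * t| * |g t|) := fun t => by
    have := NormedSpace.expSeries_div_hasSum_exp (𝔸 := ℝ) |u * t|
    rw [← Real.exp_eq_exp_ℝ] at this
    exact this.mul_right _
  -- The exponential series is integrated termwise, dominated by e^{|ut|}|g|, a product of two
  -- square-integrable functions. Each term is a monomial against g, hence zero.
  have key := hasSum_integral_of_dominated_convergence (μ := gaussianReal 0 1)
    (F := fun (k : ℕ) (t : ℝ) => (u * t * Complex.I) ^ k / (k.factorial : ℂ) * (g t : ℂ))
    (f := fun t => Complex.exp (u * t * Complex.I) * g t)
    (fun k t => |u * t| ^ k / k.factorial * |g t|) ?_ ?_ ?_ ?_ ?_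
  · refine key.unique ?_
    convert hasSum_zero using 1
    ext k
    have hk : ∀ t : ℝ, (u * t * Complex.I) ^ k / (k.factorial : ℂ) * (g t : ℂ) =
        ((u * Complex.I) ^ k / (k.factorial : ℂ)) * (((X ^ k : ℝ[X]).eval t * g t : ℝ) : ℂ) :=
      fun t => by simp only [eval_pow, eval_X]; push_cast; ring
    simp_rw [hk]
    rw [integral_const_mul, integral_complex_ofReal, h]
    simp
  · intro k
    have := hg.1
    refine AEStronglyMeasurable.mul (Continuous.aestronglyMeasurable (by fun_prop)) ?_
    exact Complex.continuous_ofReal.comp_aestronglyMeasurable this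
  · intro k
    refine Eventually.of_forall fun t => le_of_eq ?_
    simp [abs_mul]
  · exact Eventually.of_forall fun t => (hbound t).summable
  · simp_rw [fun t => (hbound t).tsum_eq]
    exact (memLp_exp_abs_mul u).integrable_mul hg.abs
  · refine Eventually.of_forall fun t => ?_
    have := NormedSpace.expSeries_div_hasSum_exp (𝔸 := ℂ) (u * t * Complex.I)
    rw [← Complex.exp_eq_exp_ℂ] at this
    exact this.mul_right _

/-- An integrable function with vanishing Fourier transform vanishes almost everywhere. -/
lemma ae_eq_zero_of_integral_cexp_mul_eq_zero {μ : Measure ℝ} [IsFiniteMeasure μ] {g : ℝ → ℝ}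
    (hgm : Measurable g) (hg : Integrable g μ)
    (h : ∀ u : ℝ, ∫ t, Complex.exp (u * t * Complex.I) * g t ∂μ = 0) : g =ᵐ[μ] 0 := by
  have hfin : ∀ f : ℝ → ℝ, Integrable f μ →
      IsFiniteMeasure (μ.withDensity fun t => ENNReal.ofReal (f t)) := fun f hf =>
    isFiniteMeasure_withDensity_ofReal hf.2
  have h1 := hfin _ hg
  have h2 := hfin _ hg.neg
  have hchar : ∀ (f : ℝ → ℝ), Measurable f → ∀ u : ℝ,
      charFun (μ.withDensity fun t => ENNReal.ofReal (f t)) u =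
      ∫ t, Complex.exp (u * t * Complex.I) * (max (f t) 0 : ℝ) ∂μ := fun f hf u => by
    rw [charFun_apply_real, integral_withDensity_eq_integral_toReal_smul
      (f := fun t => ENNReal.ofReal (f t)) (ENNReal.measurable_ofReal.comp hf) (Eventually.of_forall fun _ => ENNReal.ofReal_lt_top)]
    congr 1; ext t
    rw [ENNReal.toReal_ofReal', Complex.real_smul, mul_comm]
  have hint : ∀ f : ℝ → ℝ, Measurable f → Integrable f μ → ∀ u : ℝ,
      Integrable (fun t : ℝ => Complex.exp (u * t * Complex.I) * (max (f t) 0 : ℝ)) μ :=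
    fun f hfm hf u => by
      refine hf.pos_part.ofReal.bdd_mul (c := 1) (by fun_prop) (Eventually.of_forall fun t => ?_)
      rw [← Complex.ofReal_mul, Complex.norm_exp_ofReal_mul_I]
  -- The measures with densities g⁺ and g⁻ have the same characteristic function, so they coincide.
  have heq : (μ.withDensity fun t => ENNReal.ofReal (g t)) =
      μ.withDensity fun t => ENNReal.ofReal ((-g) t) := by
    refine Measure.ext_of_charFun (funext fun u => ?_)
    rw [hchar g hgm, hchar (-g) hgm.neg, ← sub_eq_zero,
      ← integral_sub (hint g hgm hg u) (hint (-g) hgm.neg hg.neg u), ← h u]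
    congr 1; ext t
    rw [← mul_sub, ← Complex.ofReal_sub]
    congr 2
    simp only [Pi.neg_apply]
    rcases le_total (g t) 0 with h0 | h0
    · rw [max_eq_right h0, max_eq_left (by linarith)]; ring
    · rw [max_eq_left h0, max_eq_right (by linarith)]; ring
  rw [withDensity_eq_iff_of_sigmaFinite (f := fun t => ENNReal.ofReal (g t))
    (g := fun t => ENNReal.ofReal ((-g) t)) (ENNReal.measurable_ofReal.comp hgm).aemeasurable
    (ENNReal.measurable_ofReal.comp hgm.neg).aemeasurable] at heq
  filter_upwards [heq] with t ht
  simp only [Pi.neg_apply] at ht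
  rcases le_total (g t) 0 with h0 | h0
  · rw [ENNReal.ofReal_of_nonpos h0, eq_comm, ENNReal.ofReal_eq_zero] at ht
    exact le_antisymm h0 (neg_nonpos.mp ht)
  · rw [ENNReal.ofReal_of_nonpos (by linarith : -g t ≤ 0), ENNReal.ofReal_eq_zero] at ht
    exact le_antisymm ht h0

lemma span_hermiteLp_orthogonal : (Submodule.span ℝ (Set.range hermiteLp))ᗮ = ⊥ := by
  rw [Submodule.eq_bot_iff]
  intro g hg
  have hgL : MemLp g 2 (gaussianReal 0 1) := Lp.memLp g
  have h0 : ∀ n, ∫ t, (hermiteReal n).eval t * g t ∂(gaussianReal 0 1) = 0 := fun n => by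
    have h1 := (Submodule.mem_orthogonal _ g).mp hg _ (Submodule.subset_span ⟨n, rfl⟩)
    rw [hermiteLp, ← Lp.toLp_coeFn g hgL, inner_toLp_toLp] at h1
    simp_rw [eval_normHermite, div_mul_eq_mul_div] at h1
    rw [integral_div, div_eq_zero_iff] at h1
    exact h1.resolve_right (by positivity)
  have h1 := ae_eq_zero_of_integral_cexp_mul_eq_zero (Lp.stronglyMeasurable g).measurable
    (hgL.integrable one_le_two)
    (integral_cexp_mul_eq_zero hgL (integral_eval_mul_eq_zero_of_hermiteReal hgL h0))
  exact Lp.eq_zero_iff_ae_eq_zero.mpr h1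

/-- The Hilbert basis of normalized Hermite polynomials. -/
noncomputable def hermiteBasis : HilbertBasis ℕ ℝ (Lp ℝ 2 (gaussianReal 0 1)) :=
  HilbertBasis.mkOfOrthogonalEqBot orthonormal_hermiteLp span_hermiteLp_orthogonal

/-- The sigmoid as an element of `L²` of the Gaussian. -/
noncomputable def sigmoidLp : Lp ℝ 2 (gaussianReal 0 1) :=
  (memLp_sigmoid (gaussianReal 0 1) measurable_id).toLp _

lemma inner_hermiteLp_sigmoidLp (n : ℕ) :
    inner ℝ (hermiteLp n) sigmoidLp = hermiteCoeff Real.sigmoid n := by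
  rw [hermiteLp, sigmoidLp, inner_toLp_toLp, hermiteCoeff]
  congr 1; ext t
  rw [eval_normHermite, aeval_hermite_eq_eval, mul_comm]; rfl

lemma hasSum_sigmoidLp :
    HasSum (fun n => hermiteCoeff Real.sigmoid n • hermiteLp n) sigmoidLp := by
  refine (hermiteBasis.hasSum_repr sigmoidLp).congr_of_eq (fun n => ?_) rfl
  rw [hermiteBasis.repr_apply_apply, ← inner_hermiteLp_sigmoidLp]
  simp [hermiteBasis]

lemma summable_exp_neg_mul_sqrt {c : ℝ} (hc : 0 < c) :
    Summable fun n : ℕ => Real.exp (-(c * √((n : ℝ) + 1))) := by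
  have hs : Summable fun n : ℕ => 24 / c ^ 4 * (1 / ((n : ℝ) + 1) ^ 2) := by
    refine Summable.mul_left _ ?_
    have := (summable_nat_add_iff 1).mpr (Real.summable_one_div_nat_pow.mpr one_lt_two)
    simpa using this
  refine hs.of_nonneg_of_le (fun n => (Real.exp_pos _).le) fun n => ?_
  have hn : (0 : ℝ) ≤ (n : ℝ) + 1 := by positivity
  have h1 := Real.pow_div_factorial_le_exp (c * √((n : ℝ) + 1)) (by positivity) 4
  rw [mul_pow, show (4 : ℕ) = 2 * 2 from rfl, pow_mul √_, Real.sq_sqrt hn] at h1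
  norm_num [Nat.factorial] at h1
  rw [Real.exp_neg]
  calc _ ≤ (c ^ 4 * ((n : ℝ) + 1) ^ 2 / 24)⁻¹ := inv_anti₀ (by positivity) h1
    _ = _ := by field_simp

/-- Truncated Hermite expansions approximate the sigmoid to error `e^{-Ω(√d)}`. -/
lemma exists_polynomial_approx_sigmoid :
    ∃ K c : ℝ, 0 < K ∧ 0 < c ∧ ∀ d : ℕ, ∃ p : ℝ[X], p.natDegree ≤ d ∧
      eLpNorm (fun t : ℝ => Real.sigmoid t - p.eval t) 2 (gaussianReal 0 1) ≤
        ENNReal.ofReal (K * Real.exp (-(c * √(d : ℝ)))) := by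
  obtain ⟨a, ha, hcoef⟩ := exists_abs_hermiteCoeff_sigmoid_le_exp
  have hsum := summable_exp_neg_mul_sqrt (half_pos ha)
  refine ⟨∑' n : ℕ, Real.exp (-(a / 2 * √((n : ℝ) + 1))), a / 2,
    hsum.tsum_pos (fun _ => (Real.exp_pos _).le) 0 (Real.exp_pos _), half_pos ha, fun d => ?_⟩
  set p : ℝ[X] := ∑ n ∈ Finset.range (d + 1), C (hermiteCoeff Real.sigmoid n) * normHermite n
    with hp
  refine ⟨p, ?_, ?_⟩
  · refine natDegree_sum_le_of_forall_le _ _ fun n hn => ?_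
    exact (natDegree_C_mul_le _ _).trans
      ((natDegree_normHermite_le n).trans (Nat.lt_succ_iff.mp (Finset.mem_range.mp hn)))
  have hpL : (memLp_eval_gaussianReal p).toLp _ =
      ∑ n ∈ Finset.range (d + 1), hermiteCoeff Real.sigmoid n • hermiteLp n := by
    rw [Lp.ext_iff]
    refine (MemLp.coeFn_toLp _).trans ?_
    have h2 : ∀ n ∈ Finset.range (d + 1), ∀ᵐ t ∂(gaussianReal 0 1),
        (hermiteCoeff Real.sigmoid n • hermiteLp n : Lp ℝ 2 (gaussianReal 0 1)) t =
          hermiteCoeff Real.sigmoid n * (normHermite n).eval t := fun n _ => by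
      filter_upwards [Lp.coeFn_smul (hermiteCoeff Real.sigmoid n) (hermiteLp n),
        (memLp_eval_gaussianReal (normHermite n)).coeFn_toLp] with t h3 h4
      rw [h3, Pi.smul_apply, hermiteLp, h4, smul_eq_mul]
    rw [← Filter.eventually_all_finset] at h2
    filter_upwards [h2, Lp.coeFn_finsetSum (Finset.range (d + 1))
      (fun n => hermiteCoeff Real.sigmoid n • hermiteLp n)] with t h3 h4
    rw [h4, hp, eval_finsetSum, Finset.sum_apply]
    refine Finset.sum_congr rfl fun n hn => ?_
    rw [h3 n hn, eval_mul, eval_C]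
  -- Since √(n+d+1) dominates both √(n+1) and √d, half of the rate a makes the tail summable and the
  -- other half gives the decay in d.
  have htail := ((hasSum_nat_add_iff' (d + 1)).mpr hasSum_sigmoidLp).norm_le_of_bounded
    (hsum.hasSum.mul_right (Real.exp (-(a / 2 * √(d : ℝ))))) fun n => ?_
  · have h5 : eLpNorm (fun t : ℝ => Real.sigmoid t - p.eval t) 2 (gaussianReal 0 1) =
        ‖sigmoidLp - (memLp_eval_gaussianReal p).toLp _‖ₑ := by
      rw [sigmoidLp, ← MemLp.toLp_sub, Lp.enorm_toLp]; rfl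
    rw [h5, hpL, ← ofReal_norm]
    exact ENNReal.ofReal_le_ofReal htail
  · rw [norm_smul, orthonormal_hermiteLp.norm_eq_one, mul_one, Real.norm_eq_abs]
    refine (hcoef _ (by omega)).trans ?_
    rw [← Real.exp_add, Real.exp_le_exp]
    have h6 : √((n : ℝ) + 1) ≤ √((n + (d + 1) : ℕ) : ℝ) :=
      Real.sqrt_le_sqrt (by push_cast; linarith [(Nat.cast_nonneg d : (0 : ℝ) ≤ d)])
    have h7 : √(d : ℝ) ≤ √((n + (d + 1) : ℕ) : ℝ) :=
      Real.sqrt_le_sqrt (by push_cast; linarith [(Nat.cast_nonneg n : (0 : ℝ) ≤ n)])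
    nlinarith

/-- The n-th Hermite polynomial is orthogonal to p, so this is the n-th coefficient of f - p,
bounded by Cauchy-Schwarz. -/
lemma abs_hermiteCoeff_lt_of_approximatesSigmoid {p : ℝ[X]} {ε : ℝ} (hε : 0 < ε)
    (h : ApproximatesSigmoid p ε) {n : ℕ} (hn : p.natDegree < n) :
    |hermiteCoeff Real.sigmoid n| < ε := by
  set P := (memLp_eval_gaussianReal p).toLp _ with hP
  have h0 : inner ℝ (hermiteLp n) P = 0 := by
    rw [hermiteLp, hP, inner_toLp_toLp]
    simp_rw [eval_normHermite, div_mul_eq_mul_div]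
    rw [integral_div]
    simp_rw [mul_comm ((hermiteReal n).eval _)]
    rw [integral_eval_mul_hermiteReal_eq_zero hn, zero_div]
  have h1 : ‖sigmoidLp - P‖ < ε := by
    have : ‖sigmoidLp - P‖ₑ < ENNReal.ofReal ε := by
      rw [sigmoidLp, hP, ← MemLp.toLp_sub, Lp.enorm_toLp]; exact h
    rw [← ofReal_norm] at this
    exact (ENNReal.ofReal_lt_ofReal_iff hε).mp this
  calc |hermiteCoeff Real.sigmoid n| = |inner ℝ (hermiteLp n) (sigmoidLp - P)| := by
        rw [inner_sub_right, h0, sub_zero, inner_hermiteLp_sigmoidLp]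
    _ ≤ ‖hermiteLp n‖ * ‖sigmoidLp - P‖ := abs_real_inner_le_norm _ _
    _ < ε := by rwa [orthonormal_hermiteLp.norm_eq_one, one_mul]

/-! ### Two-sided bounds in the final form for degree and coefficients -/

lemma sigmoidDegree_mem {ε : ℝ} (hε : 0 < ε) : IsLeast (sigmoidDegrees ε) (sigmoidDegree ε) := by
  refine ⟨Nat.sInf_mem ?_, fun _ h => Nat.sInf_le h⟩
  obtain ⟨K, c, hK, hc, h⟩ := exists_polynomial_approx_sigmoid
  have hlim : Tendsto (fun d : ℕ => K * Real.exp (-(c * √(d : ℝ)))) atTop (𝓝 (K * 0)) :=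
    (Real.tendsto_exp_neg_atTop_nhds_zero.comp ((Real.tendsto_sqrt_atTop.comp
      tendsto_natCast_atTop_atTop).const_mul_atTop hc)).const_mul K
  rw [mul_zero] at hlim
  obtain ⟨d, hd⟩ := (hlim.eventually (gt_mem_nhds hε)).exists
  obtain ⟨p, hp, hpe⟩ := h d
  exact ⟨d, p, hp, hpe.trans_lt ((ENNReal.ofReal_lt_ofReal_iff hε).mpr hd)⟩

lemma log_sq_le_sigmoidDegree {ε : ℝ} (hε : 0 < ε) (hL : 22 ≤ Real.log (1 / ε)) :
    Real.log (1 / ε) ^ 2 ≤ 242 * (sigmoidDegree ε : ℝ) := by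
  obtain ⟨p, hp, hpe⟩ := (sigmoidDegree_mem hε).1
  set d := sigmoidDegree ε
  -- The even coefficients vanish, so the next odd index is used. From log(1/ε) < 11√n and n ≤ d + 2
  -- the square is below 121d + 242; log(1/ε) ≥ 22 makes 242 at most half of that square.
  obtain ⟨n, hn, hn', ho⟩ : ∃ n, d < n ∧ n ≤ d + 2 ∧ Odd n := by
    rcases Nat.even_or_odd d with h | h
    · exact ⟨d + 1, by omega, by omega, h.add_one⟩
    · exact ⟨d + 2, by omega, by omega, h.add_even even_two⟩
  have h1 := (exp_le_abs_hermiteCoeff_sigmoid ho).trans_lt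
    (abs_hermiteCoeff_lt_of_approximatesSigmoid hε hpe (hp.trans_lt hn))
  rw [← Real.lt_log_iff_exp_lt hε] at h1
  rw [one_div, Real.log_inv] at *
  have h2 : √(n : ℝ) ^ 2 = n := Real.sq_sqrt (by positivity)
  have h3 : (n : ℝ) ≤ d + 2 := by exact_mod_cast hn'
  nlinarith [Real.sqrt_nonneg (n : ℝ)]

lemma exists_sigmoidDegree_le : ∃ B M : ℝ, ∀ ε : ℝ, 0 < ε → M ≤ Real.log (1 / ε) →
    (sigmoidDegree ε : ℝ) ≤ B * Real.log (1 / ε) ^ 2 := by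
  obtain ⟨K, c, hK, hc, h⟩ := exists_polynomial_approx_sigmoid
  refine ⟨4 / c ^ 2 + 1, max 1 (Real.log K), fun ε hε hM => ?_⟩
  set l := Real.log (1 / ε) with hl
  have hl1 : 1 ≤ l := (le_max_left _ _).trans hM
  have hlK : Real.log K ≤ l := (le_max_right _ _).trans hM
  -- This makes c√d > 2l: one l absorbs K and the other produces ε = e^{-l}.
  set d := ⌊(2 * l / c) ^ 2⌋₊ + 1 with hd
  obtain ⟨p, hp, hpe⟩ := h d
  have hdl : (2 * l / c) ^ 2 < d := by rw [hd]; push_cast; exact Nat.lt_floor_add_one _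
  have hdu : (d : ℝ) ≤ (2 * l / c) ^ 2 + 1 := by
    rw [hd]; push_cast; linarith [Nat.floor_le (by positivity : 0 ≤ (2 * l / c) ^ 2)]
  have hs : 2 * l / c < √(d : ℝ) := Real.lt_sqrt_of_sq_lt hdl
  have hlt : K * Real.exp (-(c * √(d : ℝ))) < ε := by
    have he : ε = Real.exp (-l) := by
      rw [hl, one_div, Real.log_inv, neg_neg, Real.exp_log hε]
    rw [he, ← Real.exp_log hK, ← Real.exp_add, Real.exp_lt_exp]
    rw [div_lt_iff₀ hc] at hs
    linarith
  have hle : sigmoidDegree ε ≤ d :=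
    Nat.sInf_le ⟨p, hp, hpe.trans_lt ((ENNReal.ofReal_lt_ofReal_iff hε).mpr hlt)⟩
  calc (sigmoidDegree ε : ℝ) ≤ d := by exact_mod_cast hle
    _ ≤ (2 * l / c) ^ 2 + 1 := hdu
    _ ≤ (4 / c ^ 2 + 1) * l ^ 2 := by
        rw [div_pow, mul_pow]
        have : (1 : ℝ) ≤ l ^ 2 := by nlinarith
        have h4 : (2 : ℝ) ^ 2 * l ^ 2 / c ^ 2 = 4 / c ^ 2 * l ^ 2 := by ring
        rw [h4]
        linarith

lemma sigmoidDegree_isTheta :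
    (fun ε : ℝ => (sigmoidDegree ε : ℝ)) =Θ[𝓝[>] 0] (fun ε : ℝ => Real.log (1 / ε) ^ 2) := by
  have hlim : Tendsto (fun ε : ℝ => Real.log (1 / ε)) (𝓝[>] 0) atTop := by
    simp_rw [one_div, Real.log_inv]
    exact tendsto_neg_atBot_atTop.comp Real.tendsto_log_nhdsGT_zero
  obtain ⟨B, M, hB⟩ := exists_sigmoidDegree_le
  constructor
  · refine IsBigO.of_bound B ?_
    filter_upwards [hlim.eventually_ge_atTop M, self_mem_nhdsWithin] with ε h1 h2
    rw [Real.norm_of_nonneg (Nat.cast_nonneg _), Real.norm_of_nonneg (sq_nonneg _)]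
    exact hB ε h2 h1
  · refine IsBigO.of_bound 242 ?_
    filter_upwards [hlim.eventually_ge_atTop 22, self_mem_nhdsWithin] with ε h1 h2
    rw [Real.norm_of_nonneg (Nat.cast_nonneg _), Real.norm_of_nonneg (sq_nonneg _)]
    exact log_sq_le_sigmoidDegree h2 h1

lemma exists_hermiteCoeff_sigmoid_bounds : ∃ a b : ℝ, 0 < a ∧ 0 < b ∧ ∀ i : ℕ, 1 ≤ i →
    Real.exp (-(b * √(i : ℝ))) ≤ |hermiteCoeff Real.sigmoid (2 * i - 1)| ∧
      |hermiteCoeff Real.sigmoid (2 * i - 1)| ≤ Real.exp (-(a * √(i : ℝ))) := by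
  obtain ⟨a, ha, h⟩ := exists_abs_hermiteCoeff_sigmoid_le_exp
  refine ⟨a, 22, ha, by norm_num, fun i hi => ⟨?_, ?_⟩⟩
  · refine le_trans ?_ (exp_le_abs_hermiteCoeff_sigmoid ⟨i - 1, by omega⟩)
    have h1 : √((2 * i - 1 : ℕ) : ℝ) ≤ 2 * √(i : ℝ) := by
      rw [Real.sqrt_le_iff]
      refine ⟨by positivity, ?_⟩
      rw [mul_pow, Real.sq_sqrt (by positivity)]
      have : ((2 * i - 1 : ℕ) : ℝ) ≤ 4 * i := by exact_mod_cast (by omega)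
      linarith
    rw [Real.exp_le_exp]
    linarith
  · refine (h _ (by omega)).trans ?_
    have h1 : √(i : ℝ) ≤ √((2 * i - 1 : ℕ) : ℝ) :=
      Real.sqrt_le_sqrt (by exact_mod_cast (by omega))
    rw [Real.exp_le_exp]
    nlinarith

/-! ### Hermite polynomials of linear forms under the multivariate Gaussian -/

instance isProbabilityMeasure_stdGaussianPi (n : ℕ) : IsProbabilityMeasure (stdGaussianPi n) := by
  unfold stdGaussianPi; infer_instance

lemma map_dotProduct_stdGaussianPi {n : ℕ} {w : Fin n → ℝ} (hw : w ⬝ᵥ w = 1) :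
    (stdGaussianPi n).map (fun x => w ⬝ᵥ x) = gaussianReal 0 1 := by
  have hm : Measurable fun x : Fin n → ℝ => w ⬝ᵥ x := by unfold dotProduct; fun_prop
  have := Measure.isProbabilityMeasure_map (μ := stdGaussianPi n) hm.aemeasurable
  refine Measure.ext_of_charFun (funext fun t => ?_)
  rw [charFun_apply_real, integral_map hm.aemeasurable (by fun_prop), charFun_gaussianReal]
  have h1 : ∀ x : Fin n → ℝ, Complex.exp (t * ((w ⬝ᵥ x : ℝ) : ℂ) * Complex.I) =
      ∏ j, Complex.exp (((t * w j : ℝ) : ℂ) * (x j : ℂ) * Complex.I) := fun x => by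
    rw [← Complex.exp_sum, dotProduct]
    congr 1
    push_cast
    rw [Finset.mul_sum, Finset.sum_mul]
    exact Finset.sum_congr rfl fun j _ => by ring
  simp_rw [h1]
  rw [stdGaussianPi, integral_fintype_prod_eq_prod (𝕜 := ℂ)
    (fun j (y : ℝ) => Complex.exp (((t * w j : ℝ) : ℂ) * (y : ℂ) * Complex.I))]
  have h2 : ∀ j, ∫ y : ℝ, Complex.exp (((t * w j : ℝ) : ℂ) * (y : ℂ) * Complex.I)
      ∂(gaussianReal 0 1) = Complex.exp (((-(t ^ 2 / 2) * (w j * w j) : ℝ) : ℂ)) := fun j => by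
    rw [← charFun_apply_real, charFun_gaussianReal]
    congr 1; push_cast; ring
  simp_rw [h2]
  rw [← Complex.exp_sum, ← Complex.ofReal_sum, ← Finset.mul_sum]
  have h3 : ∑ j, w j * w j = 1 := hw
  rw [h3]
  congr 1; push_cast; ring

/-- Integration by parts against He₁ = t. At k = 0 the truncated exponent is harmless because of the
factor k. -/
lemma integral_pow_succ_gaussianReal (k : ℕ) :
    ∫ t : ℝ, t ^ (k + 1) ∂(gaussianReal 0 1) = k * ∫ t : ℝ, t ^ (k - 1) ∂(gaussianReal 0 1) := by
  have h1 : ∀ t : ℝ, (hermiteReal 1).eval t = t := fun t => by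
    simp [hermiteReal_succ, hermiteReal_zero]
  have h0 : ∀ t : ℝ, (hermiteReal 0).eval t = 1 := fun t => by simp [hermiteReal_zero]
  have := integral_mul_hermiteReal_succ 0 (F := fun t => t ^ k)
    (F' := fun t => k * t ^ (k - 1)) (fun t => hasDerivAt_pow k t)
    (by simpa only [zero_add, h1, ← pow_succ] using integrable_pow_gaussianReal (k + 1))
    (by simpa only [h0, mul_one] using (integrable_pow_gaussianReal (k - 1)).const_mul _)
    (by simpa only [h0, mul_one] using integrable_pow_gaussianReal k)
  simpa only [zero_add, h1, h0, mul_one, ← pow_succ, integral_const_mul] using this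

lemma integrable_mvPolynomial_eval {n : ℕ} (P : MvPolynomial (Fin n) ℝ) :
    Integrable (fun x => MvPolynomial.eval x P) (stdGaussianPi n) := by
  simp_rw [MvPolynomial.eval_eq']
  exact integrable_finsetSum _ fun d _ =>
    (Integrable.fintype_prod fun i => integrable_pow_gaussianReal (d i)).const_mul _

lemma integral_monomial_eval {n : ℕ} (d : Fin n →₀ ℕ) (c : ℝ) :
    ∫ x, MvPolynomial.eval x (MvPolynomial.monomial d c) ∂(stdGaussianPi n) =
      c * ∏ i, ∫ t : ℝ, t ^ d i ∂(gaussianReal 0 1) := by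
  have h : ∀ x : Fin n → ℝ, MvPolynomial.eval x (MvPolynomial.monomial d c) =
      c * ∏ i, x i ^ d i := fun x => by
    rw [MvPolynomial.eval_monomial, Finsupp.prod_fintype _ _ (fun i => pow_zero _)]
  simp_rw [h]
  rw [integral_const_mul, stdGaussianPi,
    integral_fintype_prod_eq_prod (𝕜 := ℝ) (fun i (t : ℝ) => t ^ d i)]

/-- Gaussian integration by parts for polynomials in several variables. -/
lemma integral_X_mul_eval {n : ℕ} (j : Fin n) (P : MvPolynomial (Fin n) ℝ) :
    ∫ x, MvPolynomial.eval x (MvPolynomial.X j * P) ∂(stdGaussianPi n) =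
      ∫ x, MvPolynomial.eval x (MvPolynomial.pderiv j P) ∂(stdGaussianPi n) := by
  induction P using MvPolynomial.induction_on' with
  | monomial d c =>
    rw [MvPolynomial.X, MvPolynomial.monomial_mul, one_mul, MvPolynomial.pderiv_monomial,
      integral_monomial_eval, integral_monomial_eval, ← Finset.mul_prod_erase _ _ (Finset.mem_univ j),
      ← Finset.mul_prod_erase _ (fun i => ∫ t : ℝ, t ^ ((d - Finsupp.single j 1 : Fin n →₀ ℕ) i)
        ∂(gaussianReal 0 1)) (Finset.mem_univ j)]
    have hp : ∏ i ∈ Finset.univ.erase j, ∫ t : ℝ, t ^ ((Finsupp.single j 1 + d : Fin n →₀ ℕ) i)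
        ∂(gaussianReal 0 1) = ∏ i ∈ Finset.univ.erase j,
          ∫ t : ℝ, t ^ ((d - Finsupp.single j 1 : Fin n →₀ ℕ) i) ∂(gaussianReal 0 1) :=
      Finset.prod_congr rfl fun i hi => by
        have hij : j ≠ i := (Finset.ne_of_mem_erase hi).symm
        simp [hij]
    rw [hp]
    have hj : (Finsupp.single j 1 + d : Fin n →₀ ℕ) j = d j + 1 := by simp [add_comm]
    rw [hj, integral_pow_succ_gaussianReal]
    simp only [Finsupp.coe_tsub, Pi.sub_apply, Finsupp.single_eq_same]
    ring
  | add p q hp hq =>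
    simp only [mul_add, map_add]
    rw [integral_add (integrable_mvPolynomial_eval _) (integrable_mvPolynomial_eval _),
      integral_add (integrable_mvPolynomial_eval _) (integrable_mvPolynomial_eval _), hp, hq]

/-- The linear form `x ↦ ⟨w, x⟩` as a polynomial. -/
noncomputable def linearForm {n : ℕ} (w : Fin n → ℝ) : MvPolynomial (Fin n) ℝ :=
  ∑ j, MvPolynomial.C (w j) * MvPolynomial.X j

lemma eval_aeval_linearForm {n : ℕ} (w x : Fin n → ℝ) (p : ℝ[X]) :
    MvPolynomial.eval x (aeval (linearForm w) p) = p.eval (w ⬝ᵥ x) := by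
  have h : MvPolynomial.eval x (linearForm w) = w ⬝ᵥ x := by
    simp [linearForm, dotProduct]
  have h1 := Polynomial.aeval_algHom_apply (MvPolynomial.aeval (R := ℝ) x) (linearForm w) p
  simp only [MvPolynomial.aeval_eq_eval] at h1
  rw [← h, ← Polynomial.coe_aeval_eq_eval]
  exact h1.symm

lemma pderiv_aeval_linearForm {n : ℕ} (w : Fin n → ℝ) (j : Fin n) (p : ℝ[X]) :
    MvPolynomial.pderiv j (aeval (linearForm w) p) =
      MvPolynomial.C (w j) * aeval (linearForm w) (derivative p) := by
  have h : MvPolynomial.pderiv j (linearForm w) = MvPolynomial.C (w j) := by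
    simp [linearForm, MvPolynomial.pderiv_X, Pi.single_apply]
  rw [Derivation.map_aeval, h, smul_eq_mul, mul_comm]

lemma integrable_eval_mul_eval_dotProduct {n : ℕ} (w v : Fin n → ℝ) (p q : ℝ[X]) :
    Integrable (fun x => p.eval (w ⬝ᵥ x) * q.eval (v ⬝ᵥ x)) (stdGaussianPi n) := by
  simp_rw [← eval_aeval_linearForm, ← map_mul]
  exact integrable_mvPolynomial_eval _

/-- Coordinatewise integration by parts: ∂ⱼ brings out wⱼ from p and vⱼ from q, and summing against
wⱼ gives ⟨w,w⟩ = 1 and ⟨w,v⟩. -/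
lemma integral_X_mul_eval_dotProduct {n : ℕ} {w : Fin n → ℝ} (hw : w ⬝ᵥ w = 1) (v : Fin n → ℝ)
    (p q : ℝ[X]) :
    ∫ x, (X * p).eval (w ⬝ᵥ x) * q.eval (v ⬝ᵥ x) ∂(stdGaussianPi n) =
      ∫ x, (derivative p).eval (w ⬝ᵥ x) * q.eval (v ⬝ᵥ x) ∂(stdGaussianPi n) +
      (w ⬝ᵥ v) * ∫ x, p.eval (w ⬝ᵥ x) * (derivative q).eval (v ⬝ᵥ x) ∂(stdGaussianPi n) := by
  set A := aeval (linearForm w) p with hA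
  set B := aeval (linearForm v) q with hB
  have h1 : ∀ x : Fin n → ℝ, (X * p).eval (w ⬝ᵥ x) * q.eval (v ⬝ᵥ x) =
      ∑ j, w j * MvPolynomial.eval x (MvPolynomial.X j * (A * B)) := fun x => by
    simp only [eval_mul, eval_X, map_mul, MvPolynomial.eval_X, hA, hB, eval_aeval_linearForm]
    simp_rw [← mul_assoc, ← Finset.sum_mul]
    rfl
  have h2 : ∀ j, MvPolynomial.pderiv j (A * B) =
      MvPolynomial.C (w j) * (aeval (linearForm w) (derivative p) * B) +
      MvPolynomial.C (v j) * (A * aeval (linearForm v) (derivative q)) := fun j => by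
    rw [Derivation.leibniz, hA, hB, pderiv_aeval_linearForm, pderiv_aeval_linearForm,
      smul_eq_mul, smul_eq_mul]
    ring
  simp_rw [h1]
  rw [integral_finsetSum _ fun j _ => (integrable_mvPolynomial_eval _).const_mul _]
  simp_rw [integral_const_mul, integral_X_mul_eval, h2, map_add, map_mul, MvPolynomial.eval_C,
    hA, hB, eval_aeval_linearForm]
  have h3 : ∀ j, ∫ x, (w j * ((derivative p).eval (w ⬝ᵥ x) * q.eval (v ⬝ᵥ x)) +
      v j * (p.eval (w ⬝ᵥ x) * (derivative q).eval (v ⬝ᵥ x))) ∂(stdGaussianPi n) =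
      w j * ∫ x, (derivative p).eval (w ⬝ᵥ x) * q.eval (v ⬝ᵥ x) ∂(stdGaussianPi n) +
      v j * ∫ x, p.eval (w ⬝ᵥ x) * (derivative q).eval (v ⬝ᵥ x) ∂(stdGaussianPi n) :=
    fun j => by
      rw [integral_add ((integrable_eval_mul_eval_dotProduct _ _ _ _).const_mul _)
        ((integrable_eval_mul_eval_dotProduct _ _ _ _).const_mul _), integral_const_mul,
        integral_const_mul]
  simp_rw [h3, mul_add, Finset.sum_add_distrib, ← mul_assoc, ← Finset.sum_mul]
  have h4 : ∑ j, w j * w j = 1 := hw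
  rw [h4, one_mul]
  rfl

/-- The Hermite recursion cancels the term in which the derivative falls on the Hermite factor, so
each degree becomes one factor ⟨w,v⟩ and one derivative of q. -/
lemma integral_hermiteReal_dotProduct_mul {n : ℕ} {w : Fin n → ℝ} (hw : w ⬝ᵥ w = 1)
    (v : Fin n → ℝ) (k : ℕ) (q : ℝ[X]) :
    ∫ x, (hermiteReal k).eval (w ⬝ᵥ x) * q.eval (v ⬝ᵥ x) ∂(stdGaussianPi n) =
      (w ⬝ᵥ v) ^ k * ∫ x, (derivative^[k] q).eval (v ⬝ᵥ x) ∂(stdGaussianPi n) := by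
  induction k generalizing q with
  | zero => simp [hermiteReal_zero]
  | succ k ih =>
    have h := integral_X_mul_eval_dotProduct hw v (hermiteReal k) q
    rw [hermiteReal_succ]
    simp_rw [eval_sub, sub_mul]
    rw [integral_sub (integrable_eval_mul_eval_dotProduct _ _ _ _)
      (integrable_eval_mul_eval_dotProduct _ _ _ _), h, ih, Function.iterate_succ_apply]
    ring

/-- Mehler's formula: the correlation of Hermite polynomials of two linear forms. -/
lemma integral_normHermite_dotProduct_mul {n : ℕ} {w : Fin n → ℝ} (hw : w ⬝ᵥ w = 1)
    (v : Fin n → ℝ) (k : ℕ) :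
    ∫ x, (normHermite k).eval (w ⬝ᵥ x) * (normHermite k).eval (v ⬝ᵥ x) ∂(stdGaussianPi n) =
      (w ⬝ᵥ v) ^ k := by
  have h : ∀ x, (normHermite k).eval (w ⬝ᵥ x) * (normHermite k).eval (v ⬝ᵥ x) =
      (√(k.factorial : ℝ) * √(k.factorial : ℝ))⁻¹ *
        ((hermiteReal k).eval (w ⬝ᵥ x) * (hermiteReal k).eval (v ⬝ᵥ x)) := fun x => by
    rw [eval_normHermite, eval_normHermite]; field_simp
  simp_rw [h]
  rw [integral_const_mul, integral_hermiteReal_dotProduct_mul hw,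
    iterate_derivative_hermiteReal_self, Real.mul_self_sqrt (by positivity)]
  have : ((k.factorial : ℕ) : ℝ) ≠ 0 := by positivity
  simp only [eval_natCast, integral_const, probReal_univ, one_smul]
  field_simp

/-! ### A large family of nearly orthogonal unit vectors -/

/-- Graphs of polynomials of degree less than `k` over a prime field, as unit vectors. -/
lemma exists_nearly_orthogonal_of_prime {n q : ℕ} (k : ℕ) (hq : q.Prime) (hqn : q * q ≤ n) :
    ∃ W : (Fin k → ZMod q) → Fin n → ℝ, (∀ a, W a ⬝ᵥ W a = 1) ∧
      ∀ a b, a ≠ b → |W a ⬝ᵥ W b| ≤ (k : ℝ) / q := by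
  classical
  have : Fact q.Prime := ⟨hq⟩
  have hq0 : (0 : ℝ) < q := by exact_mod_cast hq.pos
  obtain ⟨e⟩ : Nonempty (ZMod q × ZMod q ↪ Fin n) :=
    Function.Embedding.nonempty_of_card_le (by simpa [ZMod.card] using hqn)
  let p : (Fin k → ZMod q) → (ZMod q)[X] := fun a => ((degreeLTEquiv (ZMod q) k).symm a).1
  have hp : Function.Injective p :=
    Subtype.val_injective.comp (degreeLTEquiv (ZMod q) k).symm.injective
  let W : (Fin k → ZMod q) → Fin n → ℝ := fun a =>
    ∑ x, Pi.single (e (x, (p a).eval x)) (√(q : ℝ))⁻¹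
  -- Each vector is the normalized indicator of a graph in the q × q grid, so inner products count
  -- agreements. Distinct polynomials of degree less than k agree at fewer than k points.
  have hdot : ∀ a b, W a ⬝ᵥ W b =
      ((Finset.univ.filter fun x => (p a).eval x = (p b).eval x).card : ℝ) / q := fun a b => by
    simp only [W, sum_dotProduct, dotProduct_sum, single_dotProduct, Pi.single_apply]
    have h1 : ∀ x y : ZMod q, (√(q : ℝ))⁻¹ *
        (if e (x, (p a).eval x) = e (y, (p b).eval y) then (√(q : ℝ))⁻¹ else 0) =
        if x = y then (if (p a).eval x = (p b).eval x then (q : ℝ)⁻¹ else 0) else 0 :=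
      fun x y => by
        simp only [e.injective.eq_iff, Prod.mk.injEq]
        by_cases hxy : x = y
        · subst hxy
          by_cases h : (p a).eval x = (p b).eval x
          · simp only [h, and_self, if_true]
            rw [← mul_inv, Real.mul_self_sqrt hq0.le]
          · simp [h]
        · simp [hxy]
    simp_rw [h1]
    simp [div_eq_mul_inv, ← Finset.sum_filter]
  refine ⟨W, fun a => ?_, fun a b hab => ?_⟩
  · rw [hdot]
    simp [ZMod.card, hq0.ne']
  · rw [hdot, abs_of_nonneg (by positivity)]
    gcongr
    have hne : p a - p b ≠ 0 := sub_ne_zero.mpr (hp.ne hab)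
    have hdeg : (p a - p b).degree < k :=
      mem_degreeLT.mp (Submodule.sub_mem _ ((degreeLTEquiv (ZMod q) k).symm a).2
        ((degreeLTEquiv (ZMod q) k).symm b).2)
    calc (Finset.univ.filter fun x => (p a).eval x = (p b).eval x).card
        ≤ (p a - p b).roots.toFinset.card := by
          refine Finset.card_le_card fun x hx => ?_
          rw [Finset.mem_filter] at hx
          rw [Multiset.mem_toFinset, mem_roots hne, IsRoot, eval_sub, hx.2, sub_self]
      _ ≤ (p a - p b).roots.card := Multiset.toFinset_card_le _
      _ ≤ (p a - p b).natDegree := card_roots' _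
      _ ≤ k := ((natDegree_lt_iff_degree_lt hne).mpr hdeg).le

/-- Bertrand's postulate gives a prime q ≤ √n of order √n, and k = ⌊√q⌋. With z = n^{1/8} this gives
k ≥ z, correlation k/q ≤ 1/k ≤ 1/z, and q^k ≥ 2^z vectors. The threshold 6561 = 3⁸ ensures z ≥ 3,
which absorbs the roundings. -/
lemma exists_nearly_orthogonal {n : ℕ} (hn : 6561 ≤ n) :
    ∃ (ι : Type) (_ : Fintype ι) (W : ι → Fin n → ℝ), (∀ a, W a ⬝ᵥ W a = 1) ∧
      (∀ a b, a ≠ b → |W a ⬝ᵥ W b| ≤ (n : ℝ) ^ (-(1 / 8 : ℝ))) ∧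
      (2 : ℝ) ^ ((n : ℝ) ^ (1 / 8 : ℝ)) ≤ Fintype.card ι := by
  have hnR : (6561 : ℝ) ≤ n := by exact_mod_cast hn
  have hn0 : (0 : ℝ) ≤ n := by linarith
  set z : ℝ := (n : ℝ) ^ (1 / 8 : ℝ) with hz
  have hz0 : 0 ≤ z := Real.rpow_nonneg hn0 _
  have hz8 : z ^ 8 = n := by
    rw [hz, ← Real.rpow_natCast, ← Real.rpow_mul hn0]; norm_num
  have hz3 : 3 ≤ z := by
    by_contra h
    push Not at h
    have : z ^ 8 < 3 ^ 8 := by gcongr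
    rw [hz8] at this
    linarith
  obtain ⟨q, hq, hq1, hq2⟩ := Nat.exists_prime_lt_and_le_two_mul (Nat.sqrt n / 2) (by
    have : 2 ≤ Nat.sqrt n := Nat.le_sqrt.mpr (by omega)
    omega)
  have hqs : q ≤ Nat.sqrt n := by omega
  have hqn : q * q ≤ n := Nat.le_sqrt.mp hqs
  have hs : z ^ 4 < Nat.sqrt n + 1 := by
    have h1 : (n : ℝ) < (Nat.sqrt n + 1) * (Nat.sqrt n + 1) := by
      exact_mod_cast Nat.lt_succ_sqrt n
    rw [← hz8] at h1
    refine lt_of_pow_lt_pow_left₀ 2 (by positivity) ?_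
    nlinarith
  have hqz : z ^ 4 / 4 ≤ q := by
    have h1 : Nat.sqrt n ≤ 2 * q := by omega
    have h2 : (Nat.sqrt n : ℝ) ≤ 2 * q := by exact_mod_cast h1
    have h3 : (81 : ℝ) ≤ z ^ 4 := by
      calc (81 : ℝ) = 3 ^ 4 := by norm_num
        _ ≤ z ^ 4 := by gcongr
    linarith
  have hq0 : (0 : ℝ) < q := by exact_mod_cast hq.pos
  obtain ⟨W, hW1, hW2⟩ := exists_nearly_orthogonal_of_prime (Nat.sqrt q) hq hqn
  have : NeZero q := ⟨hq.pos.ne'⟩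
  have hk1 : (Nat.sqrt q : ℝ) * Nat.sqrt q ≤ q := by exact_mod_cast Nat.sqrt_le q
  have hk2 : z ^ 2 / 2 < Nat.sqrt q + 1 := by
    have h1 : (q : ℝ) < (Nat.sqrt q + 1) * (Nat.sqrt q + 1) := by
      exact_mod_cast Nat.lt_succ_sqrt q
    refine lt_of_pow_lt_pow_left₀ 2 (by positivity) ?_
    nlinarith
  have hk : z ≤ Nat.sqrt q := by nlinarith
  refine ⟨Fin (Nat.sqrt q) → ZMod q, inferInstance, W, hW1, fun a b hab => ?_, ?_⟩
  · refine (hW2 a b hab).trans ?_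
    rw [Real.rpow_neg hn0, ← hz, div_le_iff₀ hq0, inv_mul_eq_div, le_div_iff₀ (by linarith)]
    nlinarith
  · rw [Fintype.card_fun, ZMod.card, Fintype.card_fin]
    push_cast
    calc (2 : ℝ) ^ z ≤ (2 : ℝ) ^ ((Nat.sqrt q : ℕ) : ℝ) :=
          Real.rpow_le_rpow_of_exponent_le one_le_two hk
      _ = (2 : ℝ) ^ Nat.sqrt q := Real.rpow_natCast _ _
      _ ≤ (q : ℝ) ^ Nat.sqrt q := by
          gcongr
          exact_mod_cast hq.two_le

/-! ### Correlational statistical queries -/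

/-- A vector correlates noticeably with few members of a nearly orthonormal family. -/
lemma card_mul_le_one_of_correlated {E : Type*} [NormedAddCommGroup E] [InnerProductSpace ℝ E]
    {ι : Type*} (A : Finset ι) {g : ι → E} {h : E} {κ τ : ℝ} (hκ : 0 ≤ κ)
    (hg1 : ∀ a, ‖g a‖ = 1) (hgκ : ∀ a b, a ≠ b → |inner ℝ (g a) (g b)| ≤ κ)
    (hA : ∀ a ∈ A, τ * ‖h‖ < |inner ℝ h (g a)|) (hτ0 : 0 ≤ τ) (hτ : 2 * κ ≤ τ ^ 2) :
    (A.card : ℝ) * κ ≤ 1 := by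
  classical
  rcases A.eq_empty_or_nonempty with rfl | ⟨a₀, ha₀⟩
  · simp
  set c : ι → ℝ := fun a => inner ℝ h (g a) with hc
  set S := ∑ a ∈ A, c a ^ 2 with hS
  have hh : 0 < ‖h‖ := by
    rw [norm_pos_iff]
    rintro rfl
    simpa using hA a₀ ha₀
  have hlow : (A.card : ℝ) * (τ * ‖h‖) ^ 2 ≤ S := by
    rw [hS, ← nsmul_eq_mul]
    refine Finset.card_nsmul_le_sum _ _ _ fun a ha => ?_
    rw [← sq_abs (c a)]
    have := (hA a ha).le
    gcongr
  have hSpos : 0 < S := by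
    refine Finset.sum_pos' (fun _ _ => sq_nonneg _) ⟨a₀, ha₀, ?_⟩
    rw [← sq_abs]
    exact pow_pos ((mul_nonneg hτ0 hh.le).trans_lt (hA a₀ ha₀)) 2
  have h1 : S = inner ℝ h (∑ a ∈ A, c a • g a) := by
    rw [inner_sum, hS]
    refine Finset.sum_congr rfl fun a _ => ?_
    rw [inner_smul_right, sq]
  -- Approximate Bessel: the Gram matrix is the identity plus entries of size at most κ, and
  -- (∑|cₐ|)² ≤ |A| S. With S ≥ |A| τ²‖h‖² and τ² ≥ 2κ this leaves 2κ|A| ≤ 1 + κ|A|.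
  have h2 : ‖∑ a ∈ A, c a • g a‖ ^ 2 ≤ S * (1 + κ * A.card) := by
    rw [← real_inner_self_eq_norm_sq, sum_inner]
    simp_rw [inner_sum, inner_smul_left, inner_smul_right]
    calc _ ≤ ∑ a ∈ A, ∑ b ∈ A, ((if a = b then c a ^ 2 else 0) + κ * (|c a| * |c b|)) := by
          refine Finset.sum_le_sum fun a _ => Finset.sum_le_sum fun b _ => ?_
          simp only [conj_trivial]
          by_cases hab : a = b
          · subst hab
            rw [real_inner_self_eq_norm_sq, hg1, if_pos rfl]
            have : 0 ≤ κ * (|c a| * |c a|) := by positivity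
            linarith
          · rw [if_neg hab, zero_add, ← mul_assoc]
            calc c a * c b * inner ℝ (g a) (g b) ≤ |c a * c b * inner ℝ (g a) (g b)| := le_abs_self _
              _ = |c a| * |c b| * |inner ℝ (g a) (g b)| := by rw [abs_mul, abs_mul]
              _ ≤ |c a| * |c b| * κ := by gcongr; exact hgκ a b hab
              _ = _ := mul_comm _ _
      _ = S + κ * (∑ a ∈ A, |c a|) ^ 2 := by
          simp_rw [Finset.sum_add_distrib, ← Finset.mul_sum, sq, ← Finset.sum_mul]
          congr 1
          rw [hS]
          refine Finset.sum_congr rfl fun a ha => ?_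
          simp [ha, sq]
      _ ≤ S + κ * (A.card * S) := by
          gcongr
          have := sq_sum_le_card_mul_sum_sq (s := A) (f := fun a => |c a|)
          simpa only [sq_abs] using this
      _ = _ := by ring
  have h3 : S ^ 2 ≤ ‖h‖ ^ 2 * (S * (1 + κ * A.card)) := by
    have h4 : S ≤ ‖h‖ * ‖∑ a ∈ A, c a • g a‖ := h1.le.trans (real_inner_le_norm _ _)
    calc S ^ 2 ≤ (‖h‖ * ‖∑ a ∈ A, c a • g a‖) ^ 2 := by gcongr
      _ = ‖h‖ ^ 2 * ‖∑ a ∈ A, c a • g a‖ ^ 2 := mul_pow _ _ _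
      _ ≤ _ := by gcongr
  have h5 : S ≤ ‖h‖ ^ 2 * (1 + κ * A.card) := by
    refine le_of_mul_le_mul_right ?_ hSpos
    nlinarith
  have h6 : (A.card : ℝ) * τ ^ 2 ≤ 1 + κ * A.card := by
    refine le_of_mul_le_mul_right ?_ (pow_pos hh 2)
    nlinarith
  have h7 := mul_le_mul_of_nonneg_left hτ (Nat.cast_nonneg A.card : (0 : ℝ) ≤ A.card)
  linarith

/-- The distribution of `(x, y x)` for `x` standard Gaussian. -/
noncomputable def labelledBy {n : ℕ} (y : (Fin n → ℝ) → ℝ) : Measure ((Fin n → ℝ) × ℝ) :=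
  (stdGaussianPi n).map fun x => (x, y x)

section labelledBy

variable {n : ℕ} {y : (Fin n → ℝ) → ℝ}

lemma isGaussianLabelled_labelledBy (hy : Measurable y) (hy2 : MemLp y 2 (stdGaussianPi n)) :
    IsGaussianLabelled (labelledBy y) := by
  have hm : Measurable fun x : Fin n → ℝ => (x, y x) := measurable_id.prodMk hy
  refine ⟨?_, ?_⟩
  · rw [labelledBy, Measure.map_map measurable_fst hm]
    exact Measure.map_id
  · rw [labelledBy, memLp_map_measure_iff measurable_snd.aestronglyMeasurable hm.aemeasurable]
    exact hy2

lemma integral_labelledBy (hy : Measurable y) {q : (Fin n → ℝ) → ℝ} (hq : Measurable q) :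
    ∫ z, q z.1 * z.2 ∂(labelledBy y) = ∫ x, q x * y x ∂(stdGaussianPi n) := by
  have hm : Measurable fun x : Fin n → ℝ => (x, y x) := measurable_id.prodMk hy
  have hqm : Measurable fun z : (Fin n → ℝ) × ℝ => q z.1 * z.2 :=
    (hq.comp measurable_fst).mul measurable_snd
  rw [labelledBy, integral_map hm.aemeasurable hqm.aestronglyMeasurable]

lemma l2Error_labelledBy (hy : Measurable y) {h : (Fin n → ℝ) → ℝ} (hh : Measurable h) :
    l2Error (labelledBy y) h = eLpNorm (fun x => h x - y x) 2 (stdGaussianPi n) := by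
  have hm : Measurable fun x : Fin n → ℝ => (x, y x) := measurable_id.prodMk hy
  have hhm : Measurable fun z : (Fin n → ℝ) × ℝ => h z.1 - z.2 :=
    (hh.comp measurable_fst).sub measurable_snd
  rw [l2Error, labelledBy, eLpNorm_map_measure hhm.aestronglyMeasurable hm.aemeasurable]
  rfl

end labelledBy

lemma CSQAlgorithm.hypothesis_congr {n : ℕ} {O₁ O₂ : CSQQuery n → ℝ} (A : CSQAlgorithm n)
    (h : ∀ q ∈ A.queries O₁, O₂ q = O₁ q) : A.hypothesis O₂ = A.hypothesis O₁ := by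
  induction A with
  | output f hf => rfl
  | query q next ih =>
    simp only [CSQAlgorithm.queries, List.mem_cons, forall_eq_or_imp] at h
    simp only [CSQAlgorithm.hypothesis, h.1]
    exact ih _ h.2

lemma CSQAlgorithm.measurable_hypothesis {n : ℕ} (O : CSQQuery n → ℝ) (A : CSQAlgorithm n) :
    Measurable (A.hypothesis O) := by
  induction A with
  | output f hf => exact hf
  | query q next ih => exact ih _

/-- A union bound over the queries of one run, each of which singles out at most 1/κ indices. -/
lemma card_exists_mem_mul_le {α ι : Type*} [Fintype ι] {κ : ℝ} (p : α → ι → Prop)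
    (l : List α) (h : ∀ q ∈ l, ∀ B : Finset ι, (∀ a ∈ B, p q a) → (B.card : ℝ) * κ ≤ 1)
    (B : Finset ι) (hB : ∀ a ∈ B, ∃ q ∈ l, p q a) : (B.card : ℝ) * κ ≤ l.length := by
  classical
  induction l generalizing B with
  | nil =>
    have : B = ∅ := Finset.eq_empty_of_forall_notMem fun a ha => by simpa using hB a ha
    simp [this]
  | cons q l ih =>
    have h1 := h q (by simp) (B.filter (p q)) (fun a ha => (Finset.mem_filter.mp ha).2)
    have h2 := ih (fun q' hq' => h q' (by simp [hq'])) (B.filter fun a => ¬ p q a) fun a ha => by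
      obtain ⟨haB, hna⟩ := Finset.mem_filter.mp ha
      obtain ⟨q', hq', hp⟩ := hB a haB
      rcases List.mem_cons.mp hq' with rfl | hq'
      · exact absurd hp hna
      · exact ⟨q', hq', hp⟩
    have h3 := Finset.card_filter_add_card_filter_not (s := B) (p q)
    rw [← h3, List.length_cons]
    push_cast
    linarith

/-- Labels `lam * hₘ(⟨w, x⟩)`. -/
noncomputable def hermiteLabel {n : ℕ} (m : ℕ) (lam : ℝ) (w : Fin n → ℝ) (x : Fin n → ℝ) : ℝ :=
  lam * (normHermite m).eval (w ⬝ᵥ x)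

section hermiteLabel

variable {n : ℕ} (m : ℕ)

lemma measurable_dotProduct_left (w : Fin n → ℝ) : Measurable fun x : Fin n → ℝ => w ⬝ᵥ x := by
  unfold dotProduct; fun_prop

lemma measurable_hermiteLabel (lam : ℝ) (w : Fin n → ℝ) : Measurable (hermiteLabel m lam w) :=
  ((normHermite m).continuous.measurable.comp (measurable_dotProduct_left w)).const_mul lam

lemma memLp_hermiteLabel (lam : ℝ) (w : Fin n → ℝ) :
    MemLp (hermiteLabel m lam w) 2 (stdGaussianPi n) := by
  rw [memLp_two_iff_integrable_sq (measurable_hermiteLabel m lam w).aestronglyMeasurable]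
  have h : ∀ x : Fin n → ℝ, hermiteLabel m lam w x ^ 2 = lam ^ 2 *
      ((normHermite m).eval (w ⬝ᵥ x) * (normHermite m).eval (w ⬝ᵥ x)) := fun x => by
    rw [hermiteLabel]; ring
  simp_rw [h]
  exact (integrable_eval_mul_eval_dotProduct _ _ _ _).const_mul _

lemma integral_sigmoid_mul_hermiteLabel (lam : ℝ) {w : Fin n → ℝ} (hw : w ⬝ᵥ w = 1) :
    ∫ x, Real.sigmoid (w ⬝ᵥ x) * hermiteLabel m lam w x ∂(stdGaussianPi n) =
      lam * hermiteCoeff Real.sigmoid m := by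
  have h : ∀ x, Real.sigmoid (w ⬝ᵥ x) * hermiteLabel m lam w x =
      lam * (Real.sigmoid (w ⬝ᵥ x) * (normHermite m).eval (w ⬝ᵥ x)) := fun x => by
    rw [hermiteLabel]; ring
  simp_rw [h]
  rw [integral_const_mul, hermiteCoeff, ← map_dotProduct_stdGaussianPi hw,
    integral_map (measurable_dotProduct_left w).aemeasurable]
  · simp_rw [eval_normHermite, aeval_hermite_eq_eval]
  · simp_rw [aeval_hermite_eq_eval]
    exact (continuous_sigmoid.mul
      ((hermiteReal m).continuous.div_const _)).aestronglyMeasurable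

lemma norm_toLp_hermiteLabel (lam : ℝ) {w : Fin n → ℝ} (hw : w ⬝ᵥ w = 1) :
    ‖(memLp_hermiteLabel m lam w).toLp _‖ ^ 2 = lam ^ 2 := by
  rw [← real_inner_self_eq_norm_sq, inner_toLp_toLp]
  have h : ∀ x : Fin n → ℝ, hermiteLabel m lam w x * hermiteLabel m lam w x = lam ^ 2 *
      ((normHermite m).eval (w ⬝ᵥ x) * (normHermite m).eval (w ⬝ᵥ x)) := fun x => by
    rw [hermiteLabel]; ring
  simp_rw [h]
  rw [integral_const_mul, integral_normHermite_dotProduct_mul hw, hw, one_pow, mul_one]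

/-- A square-integrable function correlates noticeably with few of the labels. -/
lemma card_mul_le_one_of_correlated_hermiteLabel {ι : Type*} {W : ι → Fin n → ℝ} {ρ lam τ : ℝ}
    (hW1 : ∀ a, W a ⬝ᵥ W a = 1) (hρ : ∀ a b, a ≠ b → |W a ⬝ᵥ W b| ≤ ρ) (hρ0 : 0 ≤ ρ)
    (hlam : lam ≠ 0) (hτ0 : 0 ≤ τ) (hτ : 2 * ρ ^ m * lam ^ 2 ≤ τ ^ 2)
    {h : (Fin n → ℝ) → ℝ} (hh : MemLp h 2 (stdGaussianPi n)) (B : Finset ι)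
    (hB : ∀ a ∈ B, τ * ‖hh.toLp h‖ < |∫ x, h x * hermiteLabel m lam (W a) x ∂(stdGaussianPi n)|) :
    (B.card : ℝ) * ρ ^ m ≤ 1 := by
  have hl : 0 < |lam| := abs_pos.mpr hlam
  have hlab : ∀ a, ∫ x, h x * hermiteLabel m lam (W a) x ∂(stdGaussianPi n) =
      lam * inner ℝ (hh.toLp h) ((memLp_hermiteLabel m 1 (W a)).toLp _) := fun a => by
    rw [inner_toLp_toLp, ← integral_const_mul]
    congr 1; ext x
    simp only [hermiteLabel]; ring
  refine card_mul_le_one_of_correlated B (τ := τ / |lam|) (h := hh.toLp h)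
    (g := fun a => (memLp_hermiteLabel m 1 (W a)).toLp _) (pow_nonneg hρ0 m) (fun a => ?_)
    (fun a b hab => ?_) (fun a ha => ?_) (by positivity) ?_
  · have := norm_toLp_hermiteLabel m 1 (hW1 a)
    rw [one_pow] at this
    exact (pow_eq_one_iff_of_nonneg (norm_nonneg _) two_ne_zero).mp this
  · rw [inner_toLp_toLp]
    simp only [hermiteLabel, one_mul]
    rw [integral_normHermite_dotProduct_mul (hW1 a), abs_pow]
    exact pow_le_pow_left₀ (abs_nonneg _) (hρ a b hab) m
  · have := hB a ha
    rw [hlab, abs_mul] at this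
    rw [div_mul_eq_mul_div, div_lt_iff₀ hl]
    linarith
  · rw [div_pow, sq_abs, le_div_iff₀ (by positivity)]
    exact hτ

/-- A hypothesis that hardly correlates with the labels has much larger error than the sigmoid. -/
lemma optError_add_lt_l2Error {C : Set ((Fin n → ℝ) → ℝ)} (hC : IncludesSigmoids C)
    {w : Fin n → ℝ} (hw : w ⬝ᵥ w = 1) {lam τ ε : ℝ} (hlam : lam * hermiteCoeff Real.sigmoid m = 1)
    (hε0 : 0 ≤ ε) (hε : 2 * ε * |lam| + ε ^ 2 + τ ^ 2 < 1) {h : (Fin n → ℝ) → ℝ}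
    (hhm : Measurable h) (hh : ∀ hL : MemLp h 2 (stdGaussianPi n),
      |∫ x, h x * hermiteLabel m lam w x ∂(stdGaussianPi n)| ≤ τ * ‖hL.toLp h‖) :
    optError (labelledBy (hermiteLabel m lam w)) C + ENNReal.ofReal ε <
      l2Error (labelledBy (hermiteLabel m lam w)) h := by
  by_contra hcon
  rw [not_lt] at hcon
  have hym := measurable_hermiteLabel m lam w
  have hy := memLp_hermiteLabel m lam w
  have hf : MemLp (fun x : Fin n → ℝ => Real.sigmoid (w ⬝ᵥ x)) 2 (stdGaussianPi n) :=
    memLp_sigmoid _ (measurable_dotProduct_left w)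
  have hfm : Measurable fun x : Fin n → ℝ => Real.sigmoid (w ⬝ᵥ x) :=
    continuous_sigmoid.measurable.comp (measurable_dotProduct_left w)
  have hopt : optError (labelledBy (hermiteLabel m lam w)) C ≤
      eLpNorm (fun x => Real.sigmoid (w ⬝ᵥ x) - hermiteLabel m lam w x) 2 (stdGaussianPi n) := by
    rw [← l2Error_labelledBy hym hfm]
    exact iInf₂_le _ (hC.2 w hw)
  rw [l2Error_labelledBy hym hhm] at hcon
  replace hcon := hcon.trans (add_le_add_left hopt _)
  have hfy : MemLp (fun x => Real.sigmoid (w ⬝ᵥ x) - hermiteLabel m lam w x) 2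
    (stdGaussianPi n) := hf.sub hy
  -- A hypothesis is only assumed measurable; near-optimality makes its error finite and so forces
  -- it into L².
  have hhy : MemLp (fun x => h x - hermiteLabel m lam w x) 2 (stdGaussianPi n) :=
    ⟨(hhm.sub hym).aestronglyMeasurable,
      hcon.trans_lt (ENNReal.add_lt_top.mpr ⟨hfy.2, ENNReal.ofReal_lt_top⟩)⟩
  have hL : MemLp h 2 (stdGaussianPi n) := by
    have := hhy.add hy
    refine this.ae_eq (Eventually.of_forall fun x => ?_)
    simp
  set Y := hy.toLp _ with hY
  set F := hf.toLp _ with hF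
  set H := hL.toLp _ with hH
  have hYn : ‖Y‖ ^ 2 = lam ^ 2 := norm_toLp_hermiteLabel m lam hw
  have hFY : inner ℝ F Y = 1 := by
    rw [hF, hY, inner_toLp_toLp, integral_sigmoid_mul_hermiteLabel m lam hw, hlam]
  have hHY : |inner ℝ H Y| ≤ τ * ‖H‖ := by
    rw [hH, hY, inner_toLp_toLp]; exact hh hL
  have hFn : ‖F‖ ^ 2 ≤ 1 := by
    rw [← real_inner_self_eq_norm_sq, hF, inner_toLp_toLp]
    calc _ ≤ ∫ _, (1 : ℝ) ∂(stdGaussianPi n) := by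
          refine integral_mono_of_nonneg (Eventually.of_forall fun x => ?_)
            (integrable_const _) (Eventually.of_forall fun x => ?_)
          · exact mul_nonneg (Real.sigmoid_nonneg _) (Real.sigmoid_nonneg _)
          · exact mul_le_one₀ (Real.sigmoid_le_one _) (Real.sigmoid_nonneg _)
              (Real.sigmoid_le_one _)
      _ = 1 := by simp
  have hle : ‖H - Y‖ ≤ ‖F - Y‖ + ε := by
    have h1 : eLpNorm (fun x => h x - hermiteLabel m lam w x) 2 (stdGaussianPi n) =
        ENNReal.ofReal ‖H - Y‖ := by
      rw [hH, hY, ← MemLp.toLp_sub, ofReal_norm, Lp.enorm_toLp]; rfl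
    have h2 : eLpNorm (fun x => Real.sigmoid (w ⬝ᵥ x) - hermiteLabel m lam w x) 2
        (stdGaussianPi n) = ENNReal.ofReal ‖F - Y‖ := by
      rw [hF, hY, ← MemLp.toLp_sub, ofReal_norm, Lp.enorm_toLp]; rfl
    rw [h1, h2, ← ENNReal.ofReal_add (norm_nonneg _) hε0] at hcon
    exact (ENNReal.ofReal_le_ofReal_iff (by positivity)).mp hcon
  have e1 : ‖H - Y‖ ^ 2 = ‖H‖ ^ 2 - 2 * inner ℝ H Y + ‖Y‖ ^ 2 := norm_sub_sq_real H Y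
  have e2 : ‖F - Y‖ ^ 2 = ‖F‖ ^ 2 - 2 * inner ℝ F Y + ‖Y‖ ^ 2 := norm_sub_sq_real F Y
  have hFle : ‖F - Y‖ ≤ |lam| := by
    refine abs_le_of_sq_le_sq' ?_ (abs_nonneg _) |>.2
    rw [sq_abs]; linarith
  -- Weak correlation gives ‖H - Y‖² ≥ λ² - τ², whereas ‖F - Y‖² ≤ λ² - 1. An excess error of at
  -- most ε would need 1 ≤ 2ε|λ| + ε² + τ².
  have h3 : ‖H - Y‖ ^ 2 ≤ (‖F - Y‖ + ε) ^ 2 := by gcongr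
  have h4 := le_of_abs_le hHY
  have h5 := mul_le_mul_of_nonneg_left hFle hε0
  nlinarith [sq_nonneg (‖H‖ - τ)]

end hermiteLabel

open Classical in
/-- Answers queries by zero when that is within their tolerance, and exactly otherwise. -/
noncomputable def lazyOracle {n : ℕ} (y : (Fin n → ℝ) → ℝ) (q : CSQQuery n) : ℝ :=
  if |∫ x, q.toFun x * y x ∂(stdGaussianPi n)| ≤ q.tolerance then 0
    else ∫ x, q.toFun x * y x ∂(stdGaussianPi n)

lemma isCSQOracle_lazyOracle {n : ℕ} {y : (Fin n → ℝ) → ℝ} (hy : Measurable y) :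
    IsCSQOracle (labelledBy y) (lazyOracle y) := fun q => by
  rw [integral_labelledBy hy q.measurable_toFun, lazyOracle]
  split_ifs with h
  · simpa using h
  · simpa using q.tolerance_pos.le

lemma CSQQuery.memLp {n : ℕ} (q : CSQQuery n) : MemLp q.toFun 2 (stdGaussianPi n) :=
  ⟨q.measurable_toFun.aestronglyMeasurable, q.norm_le_one.trans_lt ENNReal.one_lt_top⟩

lemma CSQQuery.norm_toLp_le_one {n : ℕ} (q : CSQQuery n) : ‖q.memLp.toLp q.toFun‖ ≤ 1 := by
  rw [Lp.norm_toLp]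
  exact ENNReal.toReal_le_of_le_ofReal zero_le_one (by simpa using q.norm_le_one)

/-- The lower bound for agnostic CSQ learning from a family of nearly orthogonal directions. -/
theorem csq_lower_bound_of_nearly_orthogonal {n m : ℕ} {ι : Type*} [Fintype ι]
    {W : ι → Fin n → ℝ} {ρ lam τ ε N : ℝ} (hW1 : ∀ a, W a ⬝ᵥ W a = 1)
    (hρ : ∀ a b, a ≠ b → |W a ⬝ᵥ W b| ≤ ρ) (hρ0 : 0 < ρ)
    (hlam : lam * hermiteCoeff Real.sigmoid m = 1) (hτ0 : 0 ≤ τ)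
    (hτ : 2 * ρ ^ m * lam ^ 2 ≤ τ ^ 2) (hε0 : 0 ≤ ε)
    (hε : 2 * ε * |lam| + ε ^ 2 + τ ^ 2 < 1)
    (hN : N + 1 < 2 / 3 * Fintype.card ι * ρ ^ m)
    {C : Set ((Fin n → ℝ) → ℝ)} (hC : IncludesSigmoids C) {Ω : Type*} [MeasurableSpace Ω]
    {P : Measure Ω} [IsProbabilityMeasure P] {A : Ω → CSQAlgorithm n}
    (hA : AgnosticallyLearns P A C ε) :
    ∃ (D : Measure ((Fin n → ℝ) × ℝ)) (O : CSQQuery n → ℝ) (ω : Ω),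
      IsGaussianLabelled D ∧ IsCSQOracle D O ∧
        ((∃ q ∈ (A ω).queries O, q.tolerance ≤ τ) ∨ N ≤ ((A ω).queries O).length) := by
  classical
  by_contra hcon
  push Not at hcon
  -- The negated conclusion is needed only for zero labels with the zero oracle: it bounds the
  -- reference run, which the lazy oracle reproduces for most directions.
  set O₀ : CSQQuery n → ℝ := fun _ => 0
  have hO₀ : IsCSQOracle (labelledBy (n := n) 0) O₀ := fun q => by
    rw [integral_labelledBy measurable_zero q.measurable_toFun]
    simpa [O₀] using q.tolerance_pos.le
  have hH := fun ω => hcon (labelledBy 0) O₀ ω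
    (isGaussianLabelled_labelledBy measurable_zero MemLp.zero) hO₀
  have hlam0 : lam ≠ 0 := by rintro rfl; simp at hlam
  let y : ι → (Fin n → ℝ) → ℝ := fun a => hermiteLabel m lam (W a)
  have hym : ∀ a, Measurable (y a) := fun a => measurable_hermiteLabel m lam (W a)
  choose S hSm hSP hS using fun a => hA _
    (isGaussianLabelled_labelledBy (hym a) (memLp_hermiteLabel m lam (W a))) _
    (isCSQOracle_lazyOracle (hym a))
  have hκ : 0 < ρ ^ m := pow_pos hρ0 m
  -- A seed succeeds on direction a in two ways: some query of the reference run detects a (at most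
  -- N/ρᵐ directions), or the run is unchanged and the fixed output h correlates with label a (at
  -- most 1/ρᵐ).
  have hcount : ∀ ω, ((Finset.univ.filter fun a => ω ∈ S a).card : ℝ) * ρ ^ m ≤ N + 1 :=
    fun ω => by
      set T := Finset.univ.filter fun a => ω ∈ S a
      set h := (A ω).hypothesis O₀
      set p : ι → Prop := fun a => ∃ q ∈ (A ω).queries O₀,
        q.tolerance < |∫ x, q.toFun x * y a x ∂(stdGaussianPi n)|
      have h1 : ((T.filter p).card : ℝ) * ρ ^ m ≤ ((A ω).queries O₀).length := by
        refine card_exists_mem_mul_le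
          (fun (q : CSQQuery n) a => q.tolerance < |∫ x, q.toFun x * y a x ∂(stdGaussianPi n)|)
          _ (fun q hq B hB => ?_) _ fun a ha => (Finset.mem_filter.mp ha).2
        refine card_mul_le_one_of_correlated_hermiteLabel m hW1 hρ hρ0.le hlam0 hτ0 hτ q.memLp B
          fun a ha => lt_of_le_of_lt ?_ (((hH ω).1 q hq).trans (hB a ha))
        exact mul_le_of_le_one_right hτ0 q.norm_toLp_le_one
      have h2 : ((T.filter fun a => ¬ p a).card : ℝ) * ρ ^ m ≤ 1 := by
        have hbad : ∀ a ∈ T.filter (fun a => ¬ p a), ∃ hL : MemLp h 2 (stdGaussianPi n),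
            τ * ‖hL.toLp h‖ < |∫ x, h x * y a x ∂(stdGaussianPi n)| := fun a ha => by
          obtain ⟨haT, hpa⟩ := Finset.mem_filter.mp ha
          have hωS : ω ∈ S a := (Finset.mem_filter.mp haT).2
          by_contra hno
          push Not at hno
          have heq : (A ω).hypothesis (lazyOracle (y a)) = h :=
            CSQAlgorithm.hypothesis_congr _ fun q hq => by
              refine if_pos ?_
              by_contra hlt
              exact hpa ⟨q, hq, not_le.mp hlt⟩
          have h3 := hS a ω hωS
          rw [heq] at h3
          exact absurd h3 (not_le.mpr (optError_add_lt_l2Error m hC (hW1 a) hlam hε0 hε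
            (CSQAlgorithm.measurable_hypothesis _ _) hno))
        by_cases hL : MemLp h 2 (stdGaussianPi n)
        · refine card_mul_le_one_of_correlated_hermiteLabel m hW1 hρ hρ0.le hlam0 hτ0 hτ hL _
            fun a ha => ?_
          obtain ⟨_, h4⟩ := hbad a ha
          exact h4
        · have : T.filter (fun a => ¬ p a) = ∅ :=
            Finset.eq_empty_of_forall_notMem fun a ha => hL (hbad a ha).1
          simp [this]
      have h3 := Finset.card_filter_add_card_filter_not (s := T) p
      have h4 := (hH ω).2
      rw [← h3]
      push_cast
      linarith
  have hN0 : 0 ≤ N + 1 := by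
    obtain ⟨ω⟩ : Nonempty Ω := P.nonempty_of_neZero
    exact le_trans (by positivity) (hcount ω)
  have hlow : (Fintype.card ι : ENNReal) * (2 / 3) ≤ ∑ a, P (S a) := by
    calc (Fintype.card ι : ENNReal) * (2 / 3) = ∑ _a : ι, (2 / 3 : ENNReal) := by
          rw [Finset.sum_const, Finset.card_univ, nsmul_eq_mul]
      _ ≤ _ := Finset.sum_le_sum fun a _ => hSP a
  -- Double counting of pairs (seed, direction): each direction succeeds with probability at least
  -- 2/3, while each seed serves at most (N+1)/ρᵐ directions.
  have hupp : ∑ a, P (S a) ≤ ENNReal.ofReal ((N + 1) / ρ ^ m) := by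
    calc ∑ a, P (S a) = ∑ a, ∫⁻ ω, (S a).indicator 1 ω ∂P :=
          Finset.sum_congr rfl fun a _ => (lintegral_indicator_one (hSm a)).symm
      _ = ∫⁻ ω, ∑ a, (S a).indicator 1 ω ∂P :=
          (lintegral_finsetSum _ fun a _ => measurable_one.indicator (hSm a)).symm
      _ ≤ ∫⁻ _, ENNReal.ofReal ((N + 1) / ρ ^ m) ∂P := by
          refine lintegral_mono fun ω => ?_
          have : ∑ a, (S a).indicator (1 : Ω → ENNReal) ω =
              ENNReal.ofReal ((Finset.univ.filter fun a => ω ∈ S a).card : ℝ) := by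
            rw [ENNReal.ofReal_natCast]
            simp [Set.indicator_apply]
          rw [this]
          exact ENNReal.ofReal_le_ofReal ((le_div_iff₀ hκ).mpr (hcount ω))
      _ = _ := by simp
  have hfin := hlow.trans hupp
  have hcast : (Fintype.card ι : ENNReal) * (2 / 3) =
      ENNReal.ofReal ((Fintype.card ι : ℝ) * (2 / 3)) := by
    rw [ENNReal.ofReal_mul (Nat.cast_nonneg _), ENNReal.ofReal_natCast,
      ENNReal.ofReal_div_of_pos (by norm_num)]
    simp
  rw [hcast, ENNReal.ofReal_le_ofReal_iff (by positivity), le_div_iff₀ hκ] at hfin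
  linarith

/-! ### Choice of the parameters -/

/-- The factor e^{log³ x} will bound ρ^{-m}. Being quasipolynomial, it fits in the gap between
2^{x^{1/16}} and 2^{x^{1/8}}. -/
lemma eventually_query_count_lt : ∀ᶠ x : ℝ in atTop,
    ((2 : ℝ) ^ (x ^ (1 / 16 : ℝ)) + 1) * Real.exp (Real.log x ^ 3) <
      2 / 3 * (2 : ℝ) ^ (x ^ (1 / 8 : ℝ)) := by
  have h1 := (isLittleO_log_rpow_rpow_atTop (s := 1 / 8) 3 (by norm_num)).bound
    (by norm_num : (0 : ℝ) < 1 / 8)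
  have h2 := (tendsto_rpow_atTop (y := 1 / 16) (by norm_num)).eventually_ge_atTop (4 : ℝ)
  filter_upwards [h1, h2, eventually_ge_atTop 1] with x h1 h2 hx
  have hx0 : (0 : ℝ) ≤ x := by linarith
  set z := x ^ (1 / 16 : ℝ) with hz
  have hz2 : x ^ (1 / 8 : ℝ) = z ^ 2 := by
    rw [hz, ← Real.rpow_natCast, ← Real.rpow_mul hx0]; norm_num
  have hl : 0 ≤ Real.log x := Real.log_nonneg hx
  rw [hz2] at h1 ⊢
  rw [Real.norm_of_nonneg (Real.rpow_nonneg hl _), Real.norm_of_nonneg (by positivity)] at h1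
  have h3 : Real.log x ^ 3 ≤ 1 / 8 * z ^ 2 := by
    rw [← Real.rpow_natCast]; exact_mod_cast h1
  have hlog := Real.log_two_gt_d9
  have h4 : (2 : ℝ) ^ z + 1 ≤ 2 * (2 : ℝ) ^ z := by
    have : (1 : ℝ) ≤ (2 : ℝ) ^ z := Real.one_le_rpow one_le_two (by linarith)
    linarith
  have h5 : 2 * (2 : ℝ) ^ z * Real.exp (Real.log x ^ 3) * 2 ≤ (2 : ℝ) ^ (z ^ 2) := by
    have h8 : z ^ 2 / 2 ≤ z ^ 2 - z - 2 := by nlinarith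
    have h9 : Real.log 2 * (z ^ 2 / 2) ≤ Real.log 2 * (z ^ 2 - z - 2) := by
      gcongr
    have h10 : 1 / 2 * z ^ 2 ≤ Real.log 2 * z ^ 2 := by gcongr; linarith
    rw [Real.rpow_def_of_pos two_pos, Real.rpow_def_of_pos two_pos]
    calc 2 * Real.exp (Real.log 2 * z) * Real.exp (Real.log x ^ 3) * 2
        = Real.exp (Real.log 2 + Real.log 2 * z + Real.log x ^ 3 + Real.log 2) := by
          rw [Real.exp_add, Real.exp_add, Real.exp_add, Real.exp_log two_pos]
      _ ≤ _ := by
          rw [Real.exp_le_exp]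
          generalize Real.log x ^ 3 = X at h3 ⊢
          generalize Real.log 2 = r at h9 h10 ⊢
          linarith [sq_nonneg z]
  have h6 : ((2 : ℝ) ^ z + 1) * Real.exp (Real.log x ^ 3) ≤
      2 * (2 : ℝ) ^ z * Real.exp (Real.log x ^ 3) := by gcongr
  have h7 : (0 : ℝ) < (2 : ℝ) ^ (z ^ 2) := by positivity
  linarith

lemma exists_odd_degree {l : ℝ} (hl : 44 ≤ l) :
    ∃ m : ℕ, Odd m ∧ l ^ 2 ≤ 1936 * (m : ℝ) ∧ 11 * √(m : ℝ) ≤ l / 2 := by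
  -- For m = 2i - 1 one has l²/484 - 3 < m < l²/484. The upper bound gives √m ≤ l/22; the lower one
  -- gives m ≥ l²/1936 exactly when l ≥ 44.
  set i := ⌊l ^ 2 / 968⌋₊ with hi
  have h1 : l ^ 2 / 968 < i + 1 := Nat.lt_floor_add_one _
  have h2 : (i : ℝ) ≤ l ^ 2 / 968 := Nat.floor_le (by positivity)
  have hl2 : 1936 ≤ l ^ 2 := by nlinarith
  have hi1 : 1 ≤ i := by
    rw [hi, Nat.one_le_floor_iff]; linarith
  have hi1' : (1 : ℝ) ≤ i := by exact_mod_cast hi1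
  have hm : ((2 * i - 1 : ℕ) : ℝ) = 2 * i - 1 := by
    rw [Nat.cast_sub (by omega)]; push_cast; ring
  refine ⟨2 * i - 1, ⟨i - 1, by omega⟩, ?_, ?_⟩
  · rw [hm]; linarith
  · have h3 : √((2 * i - 1 : ℕ) : ℝ) ≤ l / 22 := by
      refine Real.sqrt_le_iff.mpr ⟨by linarith, ?_⟩
      rw [hm, div_pow]
      linarith
    linarith

theorem exists_csq_lower_bound : ∃ c ε₀ : ℝ, 0 < c ∧ 0 < ε₀ ∧ ε₀ < 1 ∧
    ∀ (n : ℕ) (ε : ℝ), 0 < n → (n : ℝ) ^ (-c) ≤ ε → ε < ε₀ →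
      ∀ C : Set ((Fin n → ℝ) → ℝ), IncludesSigmoids C →
        ∀ (Ω : Type*) [MeasurableSpace Ω] (P : Measure Ω) [IsProbabilityMeasure P]
          (A : Ω → CSQAlgorithm n), AgnosticallyLearns P A C ε →
          ∃ (D : Measure ((Fin n → ℝ) × ℝ)) (O : CSQQuery n → ℝ) (ω : Ω),
            IsGaussianLabelled D ∧ IsCSQOracle D O ∧
              ((∃ q ∈ (A ω).queries O,
                  q.tolerance ≤ (n : ℝ) ^ (-(c * Real.log (1 / ε) ^ 2))) ∨
                (2 : ℝ) ^ ((n : ℝ) ^ c) ≤ ((A ω).queries O).length) := by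
  obtain ⟨M₀, hM₀⟩ := eventually_atTop.mp eventually_query_count_lt
  set c : ℝ := 1 / 100000 with hc
  set M := max M₀ 6561 with hM
  have hM1 : 6561 ≤ M := le_max_right _ _
  -- The bound ε < M^{-c} together with n^{-c} ≤ ε forces n > M, so every asymptotic inequality in n
  -- is available; e^{-44} gives l ≥ 44.
  refine ⟨c, min (Real.exp (-44)) (M ^ (-c)), by norm_num [hc], by positivity,
    (min_le_left _ _).trans_lt (by rw [Real.exp_lt_one_iff]; norm_num), ?_⟩
  intro n ε hn hnε hε₀ C hC Ω _ P _ A hA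
  have hn0 : (0 : ℝ) < n := by exact_mod_cast hn
  have hε : 0 < ε := (Real.rpow_pos_of_pos hn0 _).trans_le hnε
  have hnM : M < n := (Real.rpow_lt_rpow_iff_of_neg hn0 (by linarith) (by norm_num [hc])).mp
    (hnε.trans_lt (hε₀.trans_le (min_le_right _ _)))
  have hn6561 : 6561 ≤ n := by exact_mod_cast hM1.trans hnM.le
  have hcount := hM₀ n ((le_max_left _ _).trans hnM.le)
  set x := Real.log n with hx
  set l := Real.log (1 / ε) with hl
  have hεl : ε = Real.exp (-l) := by
    rw [hl, one_div, Real.log_inv, neg_neg, Real.exp_log hε]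
  have hl44 : 44 ≤ l := by
    have := hε₀.trans_le (min_le_left _ _)
    rw [hεl, Real.exp_lt_exp] at this
    linarith
  have hlx : l ≤ c * x := by
    rw [hεl, Real.rpow_def_of_pos hn0, Real.exp_le_exp] at hnε
    linarith
  have hx0 : 0 < x := by
    by_contra h
    push Not at h
    nlinarith [show (0 : ℝ) < c by norm_num [hc]]
  obtain ⟨m, hmo, hm1, hm2⟩ := exists_odd_degree hl44
  obtain ⟨ι, _, W, hW1, hW2, hW3⟩ := exists_nearly_orthogonal hn6561
  -- The coefficient is at least e^{-l/2} = √ε, which exceeds 4ε for small ε. Hence |λ| ≤ 1/(4ε).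
  have hcoef : 4 * ε ≤ |hermiteCoeff Real.sigmoid m| := by
    refine le_trans ?_ (exp_le_abs_hermiteCoeff_sigmoid hmo)
    calc 4 * ε ≤ Real.exp (l / 2) * Real.exp (-l) := by
          rw [hεl]; gcongr; linarith [Real.add_one_le_exp (l / 2)]
      _ = Real.exp (-(l / 2)) := by rw [← Real.exp_add]; ring_nf
      _ ≤ _ := by rw [Real.exp_le_exp]; linarith
  have hcoef0 : hermiteCoeff Real.sigmoid m ≠ 0 := abs_pos.mp (by linarith)
  have hlam : |(hermiteCoeff Real.sigmoid m)⁻¹| ≤ (4 * ε)⁻¹ := by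
    rw [abs_inv]; exact inv_anti₀ (by positivity) hcoef
  have hτ : ∀ s : ℝ, (n : ℝ) ^ s = Real.exp (x * s) := fun s => Real.rpow_def_of_pos hn0 s
  have hlxx : l ^ 3 ≤ c * l ^ 2 * x := by nlinarith [sq_nonneg l]
  have hρm : ((n : ℝ) ^ (-(1 / 8 : ℝ))) ^ m = Real.exp (-(m * x / 8)) := by
    rw [hτ, ← Real.exp_nat_mul]; ring_nf
  have hτhalf : (n : ℝ) ^ (-(c * l ^ 2)) ≤ 1 / 2 := by
    rw [hτ]
    calc Real.exp (x * -(c * l ^ 2)) ≤ Real.exp (-1) := by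
          rw [Real.exp_le_exp]
          have : (1 : ℝ) ≤ l ^ 3 := one_le_pow₀ (by linarith)
          nlinarith
      _ ≤ 1 / 2 := by
          rw [Real.exp_neg, one_div]
          exact inv_anti₀ two_pos (by linarith [Real.add_one_le_exp 1])
  have hεsmall : ε ≤ 1 / 4 := by
    rw [hεl]
    calc Real.exp (-l) = (Real.exp l)⁻¹ := Real.exp_neg l
      _ ≤ 4⁻¹ := inv_anti₀ (by norm_num) (by linarith [Real.add_one_le_exp l])
      _ = 1 / 4 := by norm_num
  refine csq_lower_bound_of_nearly_orthogonal (m := m) hW1 hW2 (Real.rpow_pos_of_pos hn0 _)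
    (inv_mul_cancel₀ hcoef0) (Real.rpow_nonneg hn0.le _) ?_ hε.le ?_ ?_ hC hA
  -- Here ρᵐ = e^{-mx/8} with mx/8 ≥ l²x/15488, while λ² costs 2l ≤ 2cl²x and τ² needs 2cl²x. It
  -- suffices that 4c ≤ 1/15488.
  · have h1 : (hermiteCoeff Real.sigmoid m)⁻¹ ^ 2 ≤ 1 / 16 * Real.exp (2 * l) := by
      rw [← sq_abs]
      calc |(hermiteCoeff Real.sigmoid m)⁻¹| ^ 2 ≤ ((4 * ε)⁻¹) ^ 2 := by gcongr
        _ = _ := by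
          rw [hεl, Real.exp_neg, two_mul, Real.exp_add]; field_simp; norm_num
    rw [hρm, hτ, ← Real.exp_nat_mul]
    calc _ ≤ 2 * Real.exp (-(m * x / 8)) * (1 / 16 * Real.exp (2 * l)) := by gcongr
      _ = 1 / 8 * Real.exp (-(m * x / 8) + 2 * l) := by rw [Real.exp_add]; ring
      _ ≤ 1 * Real.exp (-(m * x / 8) + 2 * l) := by gcongr; norm_num
      _ ≤ _ := by
        rw [one_mul, Real.exp_le_exp]
        have h2 : l ^ 2 * x ≤ 1936 * m * x := by gcongr
        have h3 : x ≤ l ^ 2 * x := le_mul_of_one_le_left hx0.le (by nlinarith)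
        push_cast
        rw [hc] at *
        nlinarith
  · have h1 : 2 * ε * |(hermiteCoeff Real.sigmoid m)⁻¹| ≤ 1 / 2 := by
      calc _ ≤ 2 * ε * (4 * ε)⁻¹ := by gcongr
        _ = 1 / 2 := by field_simp; norm_num
    have h2 : ((n : ℝ) ^ (-(c * l ^ 2))) ^ 2 ≤ (1 / 2) ^ 2 := by gcongr
    have h3 : ε ^ 2 ≤ (1 / 4) ^ 2 := by gcongr
    linarith
  -- Since √m ≤ l/22 and l ≤ cx, the loss ρ^{-m} is at most e^{x³} with x = log n.
  · have hmx : m * x / 8 ≤ x ^ 3 := by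
      have h1 : (√(m : ℝ)) ^ 2 = m := Real.sq_sqrt (Nat.cast_nonneg m)
      have h2 : √(m : ℝ) ≤ x := by
        have : c * x ≤ x := mul_le_of_le_one_left hx0.le (by norm_num [hc])
        linarith [Real.sqrt_nonneg (m : ℝ)]
      have h3 : (m : ℝ) ≤ x ^ 2 := by rw [← h1]; gcongr
      have h4 : (m : ℝ) * x ≤ x ^ 2 * x := by gcongr
      have h5 : 0 ≤ (m : ℝ) * x := by positivity
      nlinarith
    have hle : (2 : ℝ) ^ ((n : ℝ) ^ c) ≤ (2 : ℝ) ^ ((n : ℝ) ^ (1 / 16 : ℝ)) := by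
      refine Real.rpow_le_rpow_of_exponent_le one_le_two
        (Real.rpow_le_rpow_of_exponent_le ?_ (by norm_num [hc]))
      linarith
    rw [hρm, Real.exp_neg, ← div_eq_mul_inv, lt_div_iff₀ (Real.exp_pos _)]
    calc _ ≤ ((2 : ℝ) ^ ((n : ℝ) ^ (1 / 16 : ℝ)) + 1) * Real.exp (x ^ 3) := by gcongr
      _ < 2 / 3 * (2 : ℝ) ^ ((n : ℝ) ^ (1 / 8 : ℝ)) := hcount
      _ ≤ _ := by gcongr

theorem corollary5p4 :
    -- the minimal degree exists for every `ε > 0`, and is `Θ(log²(1/ε))` as `ε → 0⁺`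
    ((∀ ε : ℝ, 0 < ε → IsLeast (sigmoidDegrees ε) (sigmoidDegree ε)) ∧
      (fun ε : ℝ => (sigmoidDegree ε : ℝ)) =Θ[𝓝[>] 0] (fun ε : ℝ => Real.log (1 / ε) ^ 2)) ∧
    -- the odd Hermite coefficients have size `e^{-Θ(√i)}`
    (∃ a b : ℝ, 0 < a ∧ 0 < b ∧ ∀ i : ℕ, 1 ≤ i →
      Real.exp (-(b * Real.sqrt i)) ≤ |hermiteCoeff Real.sigmoid (2 * i - 1)| ∧
        |hermiteCoeff Real.sigmoid (2 * i - 1)| ≤ Real.exp (-(a * Real.sqrt i))) ∧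
    -- the CSQ lower bound `n^{Ω(log²(1/ε))}`
    (∃ c ε₀ : ℝ, 0 < c ∧ 0 < ε₀ ∧ ε₀ < 1 ∧
      ∀ (n : ℕ) (ε : ℝ), 0 < n → (n : ℝ) ^ (-c) ≤ ε → ε < ε₀ →
        ∀ C : Set ((Fin n → ℝ) → ℝ), IncludesSigmoids C →
          ∀ (Ω : Type*) [MeasurableSpace Ω] (P : Measure Ω) [IsProbabilityMeasure P]
            (A : Ω → CSQAlgorithm n), AgnosticallyLearns P A C ε →
            ∃ (D : Measure ((Fin n → ℝ) × ℝ)) (O : CSQQuery n → ℝ) (ω : Ω),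
              IsGaussianLabelled D ∧ IsCSQOracle D O ∧
                ((∃ q ∈ (A ω).queries O,
                    q.tolerance ≤ (n : ℝ) ^ (-(c * Real.log (1 / ε) ^ 2))) ∨
                  (2 : ℝ) ^ ((n : ℝ) ^ c) ≤ ((A ω).queries O).length)) := by
  exact ⟨⟨fun _ hε => sigmoidDegree_mem hε, sigmoidDegree_isTheta⟩,
    exists_hermiteCoeff_sigmoid_bounds, exists_csq_lower_bound⟩
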